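/- Let $H$ be an infinite-dimensional separable real Hilbert space, let $\mathcal H$ be a separable complex Hilbert space, and let $\pi$ be a strongly continuous unitary representation of the additive group of $H$ on $\mathcal H$ that has a cyclic vector (a vector $v$ such that the linear span of $\{\pi(g)v : g\in H\}$ is dense in $\mathcal H$). Let $\bar H$ be an arbitrary nuclear extension of $H$, that is, a real Hilbert space together with an injective Hilbert–Schmidt operator $J:H\to\bar H$ with dense range. For a finite Borel measure $\mu$ on $\bar H$, a linear measurable functional on $(\bar H,\mu)$ is a $\mu$-class of real measurable functions one of whose representatives is linear on a vector subspace of full measure. A pairing is a linear map $g\mapsto\langle\cdot,g\rangle$ from $H$ to the linear measurable functionals on $(\bar H,\mu)$ that is continuous from the norm topology to convergence in measure and satisfies $\langle h,J^*y\rangle=(h,y)_{\bar H}$ for $\mu$-almost every $h$, for each $y\in\bar H$. (Since $J^*\bar H$ is dense in $H$, there is at most one pairing for a given $\mu$.) A spectral realization of $\pi$ on $(\bar H,\mu)$ is a pairing together with a unitary operator $U:\mathcal H\to L^2(\bar H,\mu;\mathbb C)$ such that $$(U\pi(g)U^{-1}F)(h)=e^{i\langle h,g\rangle}F(h)\quad\text{for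 }\mu\text{-a.e. }h,\qquad g\in H,\ F\in L^2(\bar H,\mu;\mathbb C).$$ If there is one, $\mu$ is called a spectral measure of $\pi$. Then: 1. A spectral measure $\mu$ exists, and a finite Borel measure $\nu$ on $\bar H$ is a spectral measure of $\pi$ if and only if $\nu$ and $\mu$ are mutually absolutely continuous. 2. The realization is unique up to multiplication by a function: if $(\mu,U)$ and $(\nu,V)$ are spectral realizations with $\mu,\nu$ finite, there is a measurable $\varphi:\bar H\to\mathbb C$ such that for every $x\in\mathcal H$ one has $(Vx)(h)=\varphi(h)\,(Ux)(h)$ for $\nu$-a.e. $h$. 3. If a cyclic vector $v$ with $\|v\|=1$ is fixed, the realization is completely determined by the requirement that $v$ correspond to the constant function $1$: there is a Borel probability measure $\mu$ on $\bar H$ for which there is exactly one spectral realization with $Uv=1$, and every finite Borel measure $\nu$ that admits a spectral realization $V$ with $Vv=1$ is equal to $\mu$. -/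

import Mathlib

open MeasureTheory Filter Topology
open scoped InnerProductSpace ENNReal

section NuclearExtension

variable {H K : Type*} [NormedAddCommGroup H] [InnerProductSpace ℝ H]
  [NormedAddCommGroup K] [InnerProductSpace ℝ K]

/-- A bounded operator between real Hilbert spaces is Hilbert–Schmidt if `∑ ‖T bᵢ‖² < ∞` for some
(equivalently, every) orthonormal Hilbert basis `b` of the source. Any Hilbert basis can be indexed
by a subset of the space. -/
def IsHilbertSchmidt (T : H →L[ℝ] K) : Prop :=
  ∃ (s : Set H) (b : HilbertBasis s ℝ H), Summable fun i => ‖T (b i)‖ ^ 2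

/-- The Hilbert space `K`, together with `J : H → K`, is a nuclear extension of `H`: the map `J` is
an injective Hilbert–Schmidt operator with dense range. (An injective trace-class operator with
dense range is a special case.) -/
structure IsNuclearExtension (J : H →L[ℝ] K) : Prop where
  injective : Function.Injective J
  denseRange : DenseRange J
  hilbertSchmidt : IsHilbertSchmidt J

end NuclearExtension

/-- A class `f` of measurable functions modulo `μ` on a real vector space is a linear measurable
functional if one of its representatives is linear on some vector subspace of full measure. -/
def IsLinearMeasurableFunctional {E : Type*} [AddCommGroup E] [Module ℝ E] [MeasurableSpace E]
    {μ : Measure E} (f : E →ₘ[μ] ℝ) : Prop :=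
  ∃ (L : Submodule ℝ E) (l : L →ₗ[ℝ] ℝ), μ (L : Set E)ᶜ = 0 ∧
    ∀ᵐ x ∂μ, ∀ hx : x ∈ L, f x = l ⟨x, hx⟩

section Pairing

variable {H K : Type*} [NormedAddCommGroup H] [InnerProductSpace ℝ H] [CompleteSpace H]
  [NormedAddCommGroup K] [InnerProductSpace ℝ K] [CompleteSpace K] [MeasurableSpace K]

/-- `Φ` reads each `g : H` as a linear measurable functional `h ↦ ⟨h, g⟩` on `(K, μ)`.
It is linear in `g`, it extends the pairing of the Hilbert space `H` with itself
(an element of the form `g = J* y` acts as the continuous functional `h ↦ ⟪h, y⟫`, whose value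
at `h = J x` is `⟪x, g⟫`), and it is continuous from the norm topology of `H` to the
topology of convergence in measure. For an injective `J` the elements `J* y` are dense in `H`,
so these conditions determine `Φ`. -/
structure IsMeasurablePairing (J : H →L[ℝ] K) {μ : Measure K}
    (Φ : H →ₗ[ℝ] (K →ₘ[μ] ℝ)) : Prop where
  linearMeasurable : ∀ g : H, IsLinearMeasurableFunctional (Φ g)
  apply_adjoint : ∀ y : K, Φ (ContinuousLinearMap.adjoint J y) =ᵐ[μ] fun h => ⟪h, y⟫_ℝ
  tendsto_inMeasure : ∀ (u : ℕ → H) (g : H), Tendsto u atTop (𝓝 g) →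
    TendstoInMeasure μ (fun n => (Φ (u n) : K → ℝ)) atTop (Φ g)

variable {𝓗 : Type*} [NormedAddCommGroup 𝓗] [InnerProductSpace ℂ 𝓗]

/-- `v` is a cyclic vector of the unitary representation `π` of the additive group `H`:
the linear span of its orbit is dense. -/
def IsCyclicVector {G : Type*} [AddCommGroup G] (π : Multiplicative G →* (𝓗 ≃ₗᵢ[ℂ] 𝓗))
    (v : 𝓗) : Prop :=
  Dense (Submodule.span ℂ (Set.range fun g : G => π (Multiplicative.ofAdd g) v) : Set 𝓗)

/-- The unitary `U : 𝓗 → L²(K, μ; ℂ)` together with the pairing `Φ` is a spectral realization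
of `π`: after transport by `U`, the operator `π(g)` multiplies by `h ↦ exp (i ⟨h, g⟩)`. -/
structure IsSpectralRealization (J : H →L[ℝ] K) (π : Multiplicative H →* (𝓗 ≃ₗᵢ[ℂ] 𝓗))
    {μ : Measure K} (Φ : H →ₗ[ℝ] (K →ₘ[μ] ℝ)) (U : 𝓗 ≃ₗᵢ[ℂ] Lp ℂ 2 μ) : Prop where
  pairing : IsMeasurablePairing J Φ
  multiplication : ∀ (g : H) (F : Lp ℂ 2 μ),
    U (π (Multiplicative.ofAdd g) (U.symm F)) =ᵐ[μ]
      fun h => Complex.exp (Complex.I * (Φ g h : ℂ)) * F h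

/-- `μ` is a spectral measure of `π` on `K`. -/
def IsSpectralMeasure (J : H →L[ℝ] K) (π : Multiplicative H →* (𝓗 ≃ₗᵢ[ℂ] 𝓗))
    (μ : Measure K) : Prop :=
  ∃ (Φ : H →ₗ[ℝ] (K →ₘ[μ] ℝ)) (U : 𝓗 ≃ₗᵢ[ℂ] Lp ℂ 2 μ), IsSpectralRealization J π Φ U

end Pairing

/-! The theorem is the GNS construction for the positive definite function `χ g = ⟪v, π(g) v⟫`, with
`v` cyclic. The function `χ` is continuous on `H` but is in general not the characteristic function
of a measure on `H` itself. After passing to the larger space, `y ↦ χ (J* y)` is one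
(Minlos–Sazonov, `exists_charFun_eq_inner_adjoint`). On finite-dimensional subspaces the measures
come from Bochner's theorem, proved here by Plancherel. Averaging `1 - Re χ` over a Gaussian bounds
the tails by `∑ ‖J* f j‖ ^ 2`, which is finite because `J` is Hilbert–Schmidt. The approximating
measures are therefore tight, and a limit point has the required characteristic function.

Continuity of `χ` at the origin makes `⟪·, y⟫` small in measure when `J* y` is small. So the pairing
extends from the dense range of `J*` to all of `H` (`exists_isMeasurablePairing`). The functions
`exp (i⟨·, g⟩)` then have the same Gram matrix as the vectors `π(g) v`. They are total in `L²`,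
since an integrable function is determined by its Fourier transform. Matching the two families gives
`U` with `U v = 1` (`exists_isSpectralRealization`).

Uniqueness rests on one identity: in every realization `‖U v‖² μ` has the characteristic function `χ
∘ J*`, hence is one fixed measure. A cyclic vector is nonzero almost everywhere in any realization,
so all spectral measures are equivalent, and `V v / U v` is the factor relating two realizations.
Conversely, if `ν` is equivalent to `μ`, the vector corresponding to `√(dν/dμ)` is cyclic and its
spectral measure is `ν`. -/

/-! ### Multiplication by unimodular functions on `L²`. -/

section PhaseMultiplication

variable {α F : Type*} [MeasurableSpace α] {μ : Measure α} [NormedAddCommGroup F]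
  [NormedSpace ℂ F]

theorem aestronglyMeasurable_exp_I_mul {θ : α → ℝ} (hθ : AEStronglyMeasurable θ μ) :
    AEStronglyMeasurable (fun x => Complex.exp (Complex.I * θ x)) μ :=
  (by fun_prop : Continuous fun t : ℝ => Complex.exp (Complex.I * t)).comp_aestronglyMeasurable hθ

theorem MeasureTheory.MemLp.exp_I_mul_smul {p : ℝ≥0∞} {θ : α → ℝ}
    (hθ : AEStronglyMeasurable θ μ) {f : α → F} (hf : MemLp f p μ) :
    MemLp (fun x => Complex.exp (Complex.I * θ x) • f x) p μ := by
  refine hf.of_le ((aestronglyMeasurable_exp_I_mul hθ).smul hf.1) (Eventually.of_forall fun x => ?_)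
  rw [norm_smul, Complex.norm_exp_I_mul_ofReal, one_mul]

variable (F) in
/-- Multiplication by the unimodular function `x ↦ exp (i θ x)`, as an isometry of `L²`. -/
noncomputable def phaseMul (θ : α → ℝ) (hθ : AEStronglyMeasurable θ μ) :
    Lp F 2 μ →ₗᵢ[ℂ] Lp F 2 μ where
  toFun f := ((Lp.memLp f).exp_I_mul_smul hθ).toLp _
  map_add' f g := by
    ext1
    filter_upwards [((Lp.memLp (f + g)).exp_I_mul_smul hθ).coeFn_toLp,
      ((Lp.memLp f).exp_I_mul_smul hθ).coeFn_toLp, ((Lp.memLp g).exp_I_mul_smul hθ).coeFn_toLp,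
      Lp.coeFn_add f g, Lp.coeFn_add (((Lp.memLp f).exp_I_mul_smul hθ).toLp _)
        (((Lp.memLp g).exp_I_mul_smul hθ).toLp _)] with x h1 h2 h3 h4 h5
    rw [h1, h5, Pi.add_apply, h2, h3, h4, Pi.add_apply, smul_add]
  map_smul' c f := by
    ext1
    filter_upwards [((Lp.memLp (c • f)).exp_I_mul_smul hθ).coeFn_toLp,
      ((Lp.memLp f).exp_I_mul_smul hθ).coeFn_toLp,
      Lp.coeFn_smul c f, Lp.coeFn_smul c (((Lp.memLp f).exp_I_mul_smul hθ).toLp _)]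
      with x h1 h2 h4 h5
    rw [h1, RingHom.id_apply, h5, Pi.smul_apply, h2, h4, Pi.smul_apply, smul_comm]
  norm_map' f := by
    simp only [LinearMap.coe_mk, AddHom.coe_mk]
    rw [Lp.norm_toLp, Lp.norm_def]
    congr 1
    refine eLpNorm_congr_norm_ae (Eventually.of_forall fun x => ?_)
    rw [norm_smul, Complex.norm_exp_I_mul_ofReal, one_mul]

theorem coeFn_phaseMul (θ : α → ℝ) (hθ : AEStronglyMeasurable θ μ) (f : Lp F 2 μ) :
    phaseMul F θ hθ f =ᵐ[μ] fun x => Complex.exp (Complex.I * θ x) • f x :=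
  ((Lp.memLp f).exp_I_mul_smul hθ).coeFn_toLp

end PhaseMultiplication

/-! ### Limit points of tight families. -/

section CharFunLimit

/-- A tight family of probability measures whose characteristic functions converge pointwise along
a nontrivial filter has a limit point with the limiting characteristic function. -/
theorem exists_charFun_eq_of_isTightMeasureSet {E : Type*} [NormedAddCommGroup E]
    [InnerProductSpace ℝ E] [MeasurableSpace E] [BorelSpace E] {ι : Type*} {l : Filter ι} [l.NeBot]
    {μ : ι → ProbabilityMeasure E} {f : E → ℂ}
    (ht : IsTightMeasureSet {((m : ProbabilityMeasure E) : Measure E) | m ∈ Set.range μ})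
    (hf : ∀ t, Tendsto (fun i => charFun (μ i : Measure E) t) l (𝓝 (f t))) :
    ∃ ν : ProbabilityMeasure E, ∀ t, charFun (ν : Measure E) t = f t := by
  -- An ultrafilter finer than `l` replaces the choice of a convergent subsequence, so `l` may be
  -- the filter of finite sets of basis indices.
  obtain ⟨U, hU⟩ := Ultrafilter.exists_le l
  obtain ⟨ν, -, hν⟩ := (isCompact_closure_of_isTightMeasureSet ht).ultrafilter_le_nhds (U.map μ)
    (le_principal_iff.2 (mem_of_superset (Filter.univ_mem' (f := (U : Filter ι))
      (fun i => subset_closure (Set.mem_range_self i))) subset_rfl))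
  have hν' : Tendsto μ U (𝓝 ν) := hν
  refine ⟨ν, fun t => tendsto_nhds_unique ?_ ((hf t).mono_left hU)⟩
  rw [ProbabilityMeasure.tendsto_iff_forall_integral_rclike_tendsto ℂ] at hν'
  simp_rw [charFun_eq_integral_innerProbChar]
  exact hν' (BoundedContinuousFunction.innerProbChar t)

end CharFunLimit

/-! ### Bochner's theorem in finite dimension. -/

section Bochner

variable {E 𝓗 : Type*} [NormedAddCommGroup E] [InnerProductSpace ℝ E] [FiniteDimensional ℝ E]
  [MeasurableSpace E] [BorelSpace E] [NormedAddCommGroup 𝓗] [InnerProductSpace ℂ 𝓗]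

open FourierTransform SchwartzMap

/-- The Fourier transform on `L²` turns translations into multiplications by phases. -/
theorem MeasureTheory.Lp.fourier_compMeasurePreserving_add_right [CompleteSpace 𝓗]
    (u : E) (f : Lp (α := E) 𝓗 2) :
    𝓕 (Lp.compMeasurePreserving (· + u) (measurePreserving_add_right volume u) f) =
      phaseMul 𝓗 (fun ξ : E => 2 * Real.pi * ⟪u, ξ⟫_ℝ)
        (by fun_prop : Continuous fun ξ : E => 2 * Real.pi * ⟪u, ξ⟫_ℝ).aestronglyMeasurable
        (𝓕 f) := by
  refine DenseRange.induction_on (SchwartzMap.denseRange_toLpCLM (E := E) (F := 𝓗)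
    (μ := volume) (p := 2) ENNReal.ofNat_ne_top) f (isClosed_eq ?_ ?_) fun g => ?_
  · exact (Lp.fourierTransformₗᵢ E 𝓗).continuous.comp
      (Lp.compMeasurePreservingₗᵢ ℂ (· + u) (measurePreserving_add_right volume u)).continuous
  · exact (phaseMul 𝓗 _ _).continuous.comp (Lp.fourierTransformₗᵢ E 𝓗).continuous
  · have h1 : Lp.compMeasurePreserving (· + u) (measurePreserving_add_right volume u)
        (toLpCLM ℝ 𝓗 2 volume g) = (g.compSubConstCLM ℂ (-u)).toLp 2 := by
      ext1
      refine (Lp.coeFn_compMeasurePreserving _ _).trans ?_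
      refine EventuallyEq.trans ?_ (coeFn_toLp _ 2 volume).symm
      filter_upwards [(measurePreserving_add_right volume u).quasiMeasurePreserving.ae_eq_comp
        (coeFn_toLp g 2 volume)] with x hx
      rw [toLpCLM_apply, hx]
      simp
    rw [h1, toLpCLM_apply, toLp_fourier_eq, toLp_fourier_eq]
    ext1
    refine (coeFn_toLp _ 2 volume).trans (EventuallyEq.trans ?_ (coeFn_phaseMul _ _ _).symm)
    filter_upwards [coeFn_toLp (𝓕 g) 2 volume] with ξ hξ
    rw [hξ, fourier_coe, fourier_coe]
    have h2 := congrFun (VectorFourier.fourierIntegral_comp_add_right Real.fourierChar volume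
      (innerₗ E) (g : E → 𝓗) u) ξ
    have h3 : (g.compSubConstCLM ℂ (-u) : E → 𝓗) = (g : E → 𝓗) ∘ fun v => v + u := by
      ext x; simp
    rw [h3]
    refine h2.trans ?_
    rw [Circle.smul_def, Real.fourierChar_apply]
    simp only [innerₗ_apply_apply]
    rw [mul_comm Complex.I]
    rfl

/-- A unit vector `F` of `L²` defines the probability measure with density `‖F‖²`; after rescaling
its characteristic function is given by the multiplication operators. -/
theorem exists_charFun_eq_inner_phaseMul (F : Lp (α := E) 𝓗 2) (hF : ‖F‖ = 1) :
    ∃ μ : ProbabilityMeasure E, ∀ u : E, charFun (μ : Measure E) u =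
      ⟪F, phaseMul 𝓗 (fun ξ : E => 2 * Real.pi * ⟪u, ξ⟫_ℝ)
        (by fun_prop : Continuous fun ξ : E => 2 * Real.pi * ⟪u, ξ⟫_ℝ).aestronglyMeasurable
        F⟫_ℂ := by
  obtain ⟨f, hfm, hf⟩ := (Lp.aestronglyMeasurable F)
  have hdm : Measurable fun ξ => ‖f ξ‖ₑ ^ 2 := (hfm.enorm).pow_const 2
  set m : Measure E := volume.withDensity fun ξ => ‖f ξ‖ₑ ^ 2 with hm
  have hint : ∀ φ : E → ℂ, ∫ ξ, φ ξ ∂m = ∫ ξ, ⟪F ξ, φ ξ • F ξ⟫_ℂ := by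
    intro φ
    rw [hm, integral_withDensity_eq_integral_toReal_smul hdm
      (Eventually.of_forall fun ξ => by simp)]
    refine integral_congr_ae ?_
    filter_upwards [hf] with ξ hξ
    rw [hξ, inner_smul_right, inner_self_eq_norm_sq_to_K]
    simp [mul_comm]
  have hm1 : IsProbabilityMeasure m := by
    constructor
    rw [hm, withDensity_apply _ MeasurableSet.univ, Measure.restrict_univ]
    have h1 := hF
    rw [Lp.norm_def, eLpNorm_eq_lintegral_rpow_enorm_toReal (by norm_num) (by norm_num)] at h1
    have h2 : ∫⁻ ξ, ‖F ξ‖ₑ ^ (2 : ℝ) = ∫⁻ ξ, ‖f ξ‖ₑ ^ 2 := by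
      refine lintegral_congr_ae ?_
      filter_upwards [hf] with ξ hξ
      rw [hξ]; norm_cast
    simp only [ENNReal.toReal_ofNat, h2] at h1
    have h3 := (ENNReal.toReal_eq_one_iff _).1 h1
    have h4 := congrArg (fun x : ℝ≥0∞ => x ^ (2 : ℝ)) h3
    rw [← ENNReal.rpow_mul] at h4
    simpa using h4
  have hmm : Measurable fun ξ : E => (2 * Real.pi) • ξ := measurable_const_smul _
  refine ⟨⟨m.map fun ξ => (2 * Real.pi) • ξ, Measure.isProbabilityMeasure_map hmm.aemeasurable⟩,
    fun u => ?_⟩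
  change charFun (m.map fun ξ => (2 * Real.pi) • ξ) u = _
  rw [charFun_apply, integral_map hmm.aemeasurable (by fun_prop), hint, L2.inner_def]
  refine integral_congr_ae ?_
  filter_upwards [coeFn_phaseMul (fun ξ : E => 2 * Real.pi * ⟪u, ξ⟫_ℝ)
    (by fun_prop : Continuous fun ξ : E => 2 * Real.pi * ⟪u, ξ⟫_ℝ).aestronglyMeasurable F]
    with ξ hξ
  rw [hξ, real_inner_smul_left, real_inner_comm, mul_comm Complex.I]

/-- **Bochner's theorem** for the matrix coefficient of a unitary representation. -/
theorem exists_probabilityMeasure_charFun_eq_inner [CompleteSpace 𝓗] (ρ : E → 𝓗 →ₗᵢ[ℂ] 𝓗)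
    (hadd : ∀ x y z, ρ (x + y) z = ρ x (ρ y z)) (hρ : ∀ z, Continuous fun x => ρ x z)
    (v : 𝓗) (hv : ‖v‖ = 1) :
    ∃ μ : ProbabilityMeasure E, ∀ u, charFun (μ : Measure E) u = ⟪v, ρ u v⟫_ℂ := by
  have hzero : ∀ z, ρ 0 z = z := fun z => (ρ 0).injective (by rw [← hadd, add_zero])
  -- approximation with a Gaussian factor
  have key : ∀ ε : ℝ, 0 < ε → ∃ μ : ProbabilityMeasure E, ∀ u, charFun (μ : Measure E) u =
      Complex.exp (-(ε * ‖u‖ ^ 2 / 2 : ℝ)) * ⟪v, ρ u v⟫_ℂ := by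
    intro ε hε
    -- The vector-valued function `g x = a x • ρ x v` lies in `L²`. Its autocorrelation is `⟪v, ρ u
    -- v⟫` times a Gaussian in `u`, because `⟪ρ x v, ρ (x + u) v⟫` does not depend on `x`. By
    -- Plancherel that autocorrelation is the Fourier transform of the density `‖𝓕 g‖²`.
    let a : E → ℝ := fun x => Real.exp (-(ε * ‖x‖ ^ 2))
    have hsq : ∀ x, a x ^ 2 = Real.exp (-(2 * ε) * ‖x‖ ^ 2) := fun x => by
      simp only [a, ← Real.exp_nat_mul]; congr 1; push_cast; ring
    have hai : Integrable fun x => a x ^ 2 := by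
      have := (GaussianFourier.integrable_cexp_neg_mul_sq_norm_add (V := E) (b := (2 * ε : ℝ))
        (by simpa using hε) 0 0).norm
      refine this.congr (Eventually.of_forall fun x => ?_)
      simp only [hsq, Complex.norm_exp]
      congr 1
      simp [← Complex.ofReal_pow]
    have ham : MemLp (fun x => (a x : ℂ) • ρ x v) 2 (volume : Measure E) := by
      have hc : Continuous fun x => (a x : ℂ) • ρ x v := by
        have := hρ v
        fun_prop
      rw [← memLp_norm_iff hc.aestronglyMeasurable]
      refine (memLp_two_iff_integrable_sq hc.norm.aestronglyMeasurable).2 ?_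
      refine hai.congr (Eventually.of_forall fun x => ?_)
      simp [norm_smul, hv]
    set C := ∫ x, a x ^ 2 with hC
    have hCpos : 0 < C := by
      rw [hC, integral_pos_iff_support_of_nonneg (fun x => by positivity) hai]
      have : Function.support (fun x => a x ^ 2) = Set.univ := by
        ext x; simp [a]
      rw [this]
      exact Measure.measure_univ_pos.2 (NeZero.ne _)
    set g := ham.toLp _ with hg
    have hgg : ∀ u, ⟪g, Lp.compMeasurePreserving (· + u) (measurePreserving_add_right volume u) g⟫_ℂ
        = C * (Complex.exp (-(ε * ‖u‖ ^ 2 / 2 : ℝ)) * ⟪v, ρ u v⟫_ℂ) := by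
      intro u
      -- Parallelogram identity around the midpoint: `‖x‖² + ‖x + u‖² = 2 ‖x + u/2‖² + ‖u‖²/2`.
      have h1 : ∀ x, a x * a (x + u) = Real.exp (-(ε * ‖u‖ ^ 2 / 2)) *
          a (x + (2⁻¹ : ℝ) • u) ^ 2 := by
        intro x
        rw [hsq]
        simp only [a, ← Real.exp_add]
        congr 1
        rw [norm_add_sq_real, norm_add_sq_real, norm_smul, inner_smul_right]
        norm_num
        ring
      rw [L2.inner_def]
      have h2 : ∀ᵐ x, ⟪g x, Lp.compMeasurePreserving (· + u)
          (measurePreserving_add_right volume u) g x⟫_ℂ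
          = ((a (x + (2⁻¹ : ℝ) • u) ^ 2 : ℝ) : ℂ) *
            (Complex.exp (-(ε * ‖u‖ ^ 2 / 2 : ℝ)) * ⟪v, ρ u v⟫_ℂ) := by
        filter_upwards [ham.coeFn_toLp, Lp.coeFn_compMeasurePreserving g
          (measurePreserving_add_right volume u),
          (measurePreserving_add_right volume u).quasiMeasurePreserving.ae_eq_comp
          ham.coeFn_toLp] with x hx1 hx2 hx3
        rw [hx2, hx3, hx1]
        simp only [Function.comp_apply]
        rw [inner_smul_left, inner_smul_right, hadd, (ρ x).inner_map_map, Complex.conj_ofReal,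
          ← mul_assoc, ← Complex.ofReal_mul, h1]
        push_cast
        ring
      rw [integral_congr_ae h2, integral_mul_const, integral_complex_ofReal,
        integral_add_right_eq_self (fun x => a x ^ 2)]
    have hgn : ‖g‖ ^ 2 = C := by
      have h0 := hgg 0
      have h1 : Lp.compMeasurePreserving (· + (0 : E)) (measurePreserving_add_right volume 0) g
          = g := by
        ext1
        filter_upwards [Lp.coeFn_compMeasurePreserving g
          (measurePreserving_add_right volume (0 : E))] with x hx
        rw [hx]; simp
      rw [h1, hzero, inner_self_eq_norm_sq_to_K, inner_self_eq_norm_sq_to_K, hv] at h0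
      simp only [norm_zero] at h0
      norm_num at h0
      exact_mod_cast h0
    have hg0 : ‖g‖ ≠ 0 := fun h => by rw [h] at hgn; norm_num at hgn; linarith
    obtain ⟨μ, hμ⟩ := exists_charFun_eq_inner_phaseMul (𝓕 ((‖g‖⁻¹ : ℂ) • g)) (by
      rw [Lp.norm_fourier_eq, norm_smul]; simp [hg0])
    refine ⟨μ, fun u => ?_⟩
    rw [hμ, ← Lp.fourier_compMeasurePreserving_add_right, Lp.inner_fourier_eq,
      show Lp.compMeasurePreserving (· + u) (measurePreserving_add_right volume u)
        ((‖g‖⁻¹ : ℂ) • g) = (‖g‖⁻¹ : ℂ) • Lp.compMeasurePreserving (· + u)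
          (measurePreserving_add_right volume u) g from
        (Lp.compMeasurePreservingₗᵢ ℂ (· + u) (measurePreserving_add_right volume u)).map_smul _ _,
      inner_smul_left, inner_smul_right, hgg, ← hgn]
    have : (‖g‖ : ℂ) ≠ 0 := by exact_mod_cast hg0
    simp only [map_inv₀, Complex.conj_ofReal]
    push_cast
    field_simp
  have : Nonempty (ProbabilityMeasure E) := ⟨(key 1 one_pos).choose⟩
  choose! M hM using key
  have hlim : ∀ u, Tendsto (fun n : ℕ => charFun (M (1 / ((n : ℝ) + 1)) : Measure E) u) atTop
      (𝓝 ⟪v, ρ u v⟫_ℂ) := by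
    intro u
    have h1 : Tendsto (fun n : ℕ => Complex.exp (-((1 / ((n : ℝ) + 1)) * ‖u‖ ^ 2 / 2 : ℝ)) *
        ⟪v, ρ u v⟫_ℂ) atTop (𝓝 (Complex.exp (-((0 : ℝ) * ‖u‖ ^ 2 / 2 : ℝ)) * ⟪v, ρ u v⟫_ℂ)) := by
      have hc : Continuous fun s : ℝ => Complex.exp (-(s * ‖u‖ ^ 2 / 2 : ℝ)) * ⟪v, ρ u v⟫_ℂ := by
        fun_prop
      exact (hc.tendsto 0).comp tendsto_one_div_add_atTop_nhds_zero_nat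
    simp only [zero_mul, zero_div, Complex.ofReal_zero, neg_zero, Complex.exp_zero, one_mul] at h1
    refine h1.congr fun n => ?_
    rw [hM _ (by positivity)]
  refine exists_charFun_eq_of_isTightMeasureSet
    (μ := fun n : ℕ => M (1 / ((n : ℝ) + 1))) (l := atTop) ?_ hlim
  -- Tightness as in Lévy's theorem: the limit of the characteristic functions is continuous.
  have ht := isTightMeasureSet_of_tendsto_charFun
    (μ := fun n : ℕ => (M (1 / ((n : ℝ) + 1)) : Measure E)) (f := fun u => ⟪v, ρ u v⟫_ℂ)
    (by have := hρ v; fun_prop) hlim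
  convert ht using 1
  ext m
  simp

end Bochner

/-! ### Gaussian averages and tail estimates. -/

section GaussianAverage

open ProbabilityTheory

variable {H K D : Type*} [NormedAddCommGroup H] [InnerProductSpace ℝ H]
  [NormedAddCommGroup K] [InnerProductSpace ℝ K] [Fintype D]

/-- The linear map `z ↦ ∑ j, z j • a j`. -/
noncomputable def linearCombinationCLM (a : D → K) : EuclideanSpace ℝ D →L[ℝ] K :=
  ∑ j, (EuclideanSpace.proj j : EuclideanSpace ℝ D →L[ℝ] ℝ).smulRight (a j)

@[simp]
theorem linearCombinationCLM_apply (a : D → K) (z : EuclideanSpace ℝ D) :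
    linearCombinationCLM a z = ∑ j, z j • a j := by
  simp [linearCombinationCLM]

/-- The dual map of `linearCombinationCLM`. -/
noncomputable def innerCoordinates (a : D → K) (h : K) : EuclideanSpace ℝ D :=
  WithLp.toLp 2 fun j => ⟪h, a j⟫_ℝ

theorem inner_linearCombinationCLM (a : D → K) (z : EuclideanSpace ℝ D) (h : K) :
    ⟪linearCombinationCLM a z, h⟫_ℝ = ⟪z, innerCoordinates a h⟫_ℝ := by
  rw [linearCombinationCLM_apply, sum_inner, PiLp.inner_apply]
  refine Finset.sum_congr rfl fun j _ => ?_
  rw [real_inner_smul_left, real_inner_comm]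
  simp [innerCoordinates, mul_comm]

theorem norm_innerCoordinates_sq (a : D → K) (h : K) :
    ‖innerCoordinates a h‖ ^ 2 = ∑ j, ⟪h, a j⟫_ℝ ^ 2 := by
  simp [innerCoordinates, EuclideanSpace.norm_sq_eq]

theorem integral_mul_stdGaussian [DecidableEq D] (i j : D) :
    ∫ z, z i * z j ∂(stdGaussian (EuclideanSpace ℝ D)) = if i = j then 1 else 0 := by
  have h := covarianceBilin_apply (μ := stdGaussian (EuclideanSpace ℝ D))
    IsGaussian.memLp_two_id (EuclideanSpace.single i (1 : ℝ)) (EuclideanSpace.single j 1)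
  rw [covarianceBilin_stdGaussian] at h
  simp only [id, integral_id_stdGaussian, sub_zero, innerSL_apply_apply ℝ,
    EuclideanSpace.inner_single_left, map_one, one_mul] at h
  rw [← h]
  simp

theorem memLp_clm_stdGaussian (B : EuclideanSpace ℝ D →L[ℝ] H) :
    MemLp B 2 (stdGaussian (EuclideanSpace ℝ D)) :=
  B.comp_memLp' IsGaussian.memLp_two_id

/-- The coordinates are uncorrelated with unit variance, so only diagonal terms survive. This is how
a quadratic bound on `χ` becomes a Hilbert–Schmidt sum. -/
theorem integral_norm_sq_stdGaussian (a : D → H) :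
    ∫ z, ‖linearCombinationCLM a z‖ ^ 2 ∂(stdGaussian (EuclideanSpace ℝ D)) = ∑ j, ‖a j‖ ^ 2 := by
  classical
  have h1 : ∀ z : EuclideanSpace ℝ D, ‖linearCombinationCLM a z‖ ^ 2 =
      ∑ i, ∑ j, (z i * z j) * ⟪a i, a j⟫_ℝ := by
    intro z
    rw [← real_inner_self_eq_norm_sq, linearCombinationCLM_apply, sum_inner]
    refine Finset.sum_congr rfl fun i _ => ?_
    rw [inner_sum]
    refine Finset.sum_congr rfl fun j _ => ?_
    rw [real_inner_smul_left, real_inner_smul_right]; ring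
  have h2 : ∀ i j : D, Integrable (fun z : EuclideanSpace ℝ D => (z i * z j) * ⟪a i, a j⟫_ℝ)
      (stdGaussian (EuclideanSpace ℝ D)) := fun i j =>
    ((memLp_clm_stdGaussian (EuclideanSpace.proj i)).integrable_mul
      (memLp_clm_stdGaussian (EuclideanSpace.proj j))).mul_const _
  simp_rw [h1]
  rw [integral_finsetSum _ fun i _ => integrable_finsetSum _ fun j _ => h2 i j]
  refine Finset.sum_congr rfl fun i _ => ?_
  rw [integral_finsetSum _ fun j _ => h2 i j]
  simp [integral_mul_const, integral_mul_stdGaussian]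

variable [MeasurableSpace K] [BorelSpace K]

/-- Averaging the characteristic function over a Gaussian measure. -/
theorem integral_exp_neg_sum_sq_eq (μ : Measure K) [IsProbabilityMeasure μ] (a : D → K) :
    Integrable (fun z => (charFun μ (linearCombinationCLM a z)).re)
      (stdGaussian (EuclideanSpace ℝ D)) ∧
    ∫ h, Real.exp (-(∑ j, ⟪h, a j⟫_ℝ ^ 2) / 2) ∂μ =
      ∫ z, (charFun μ (linearCombinationCLM a z)).re ∂(stdGaussian (EuclideanSpace ℝ D)) := by
  set γ := stdGaussian (EuclideanSpace ℝ D)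
  have hi : Integrable (fun p : K × EuclideanSpace ℝ D =>
      Complex.exp (⟪p.1, linearCombinationCLM a p.2⟫_ℝ * Complex.I)) (μ.prod γ) := by
    refine Integrable.of_bound (C := 1) ?_ (Eventually.of_forall fun p => ?_)
    · exact Continuous.aestronglyMeasurable (by fun_prop)
    · rw [Complex.norm_exp_ofReal_mul_I]
  have h1 : Integrable (fun z => charFun μ (linearCombinationCLM a z)) γ := hi.integral_prod_right
  have h2 : ∫ h, Complex.exp (-(∑ j, ⟪h, a j⟫_ℝ ^ 2 : ℝ) / 2) ∂μ =
      ∫ z, charFun μ (linearCombinationCLM a z) ∂γ := by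
    simp_rw [charFun_apply]
    -- Fubini: for fixed `h`, the integral over `z` is the Gaussian characteristic function at the
    -- coordinates of `h`.
    rw [← integral_integral_swap (f := fun (h : K) (z : EuclideanSpace ℝ D) =>
      Complex.exp (⟪h, linearCombinationCLM a z⟫_ℝ * Complex.I)) hi]
    refine integral_congr_ae (Eventually.of_forall fun h => ?_)
    have e : ∀ z, ⟪h, linearCombinationCLM a z⟫_ℝ = ⟪z, innerCoordinates a h⟫_ℝ := fun z => by
      rw [real_inner_comm, inner_linearCombinationCLM]
    simp only [e]
    rw [← charFun_apply, charFun_stdGaussian, ← Complex.ofReal_pow, norm_innerCoordinates_sq]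
  refine ⟨h1.re, ?_⟩
  have h3 := congrArg Complex.re h2
  have h4 : ∀ h : K, Complex.exp (-(∑ j, ⟪h, a j⟫_ℝ ^ 2 : ℝ) / 2) =
      ((Real.exp (-(∑ j, ⟪h, a j⟫_ℝ ^ 2) / 2) : ℝ) : ℂ) := fun h => by push_cast; rfl
  simp_rw [h4] at h3
  rw [integral_complex_ofReal, Complex.ofReal_re] at h3
  rw [h3]
  exact (integral_re h1).symm

/-- A bound on `1 - Re μ̂` by a quadratic form controls the tails of `μ`. -/
theorem measureReal_two_le_sum_sq_le (μ : Measure K) [IsProbabilityMeasure μ] (T : K →ₗ[ℝ] H)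
    {ε C : ℝ} (hT : ∀ y, 1 - (charFun μ y).re ≤ ε + C * ‖T y‖ ^ 2) (a : D → K) :
    μ.real {h | 2 ≤ ∑ j, ⟪h, a j⟫_ℝ ^ 2} ≤ 2 * (ε + C * ∑ j, ‖T (a j)‖ ^ 2) := by
  obtain ⟨h1, h2⟩ := integral_exp_neg_sum_sq_eq μ a
  set γ := stdGaussian (EuclideanSpace ℝ D)
  have hc : Continuous fun h : K => Real.exp (-(∑ j, ⟪h, a j⟫_ℝ ^ 2) / 2) := by fun_prop
  have hle : ∀ h : K, Real.exp (-(∑ j, ⟪h, a j⟫_ℝ ^ 2) / 2) ≤ 1 := fun h => by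
    rw [Real.exp_le_one_iff]
    have : 0 ≤ ∑ j, ⟪h, a j⟫_ℝ ^ 2 := by positivity
    linarith
  have hie : Integrable (fun h : K => Real.exp (-(∑ j, ⟪h, a j⟫_ℝ ^ 2) / 2)) μ := by
    refine Integrable.of_bound hc.aestronglyMeasurable 1 (Eventually.of_forall fun h => ?_)
    rw [Real.norm_eq_abs, Real.abs_exp]
    exact hle h
  have hT2 : ∀ z, T (linearCombinationCLM a z) = linearCombinationCLM (fun j => T (a j)) z := by
    intro z; simp [map_sum]
  have hsq : Integrable (fun z => ‖linearCombinationCLM (fun j => T (a j)) z‖ ^ 2) γ :=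
    (memLp_clm_stdGaussian (linearCombinationCLM fun j => T (a j))).integrable_norm_pow
      (by norm_num)
  have h3 : 1 - ∫ h, Real.exp (-(∑ j, ⟪h, a j⟫_ℝ ^ 2) / 2) ∂μ ≤
      ε + C * ∑ j, ‖T (a j)‖ ^ 2 := by
    rw [h2, ← integral_norm_sq_stdGaussian, ← integral_const_mul]
    have e1 : 1 - ∫ z, (charFun μ (linearCombinationCLM a z)).re ∂γ =
        ∫ z, (1 - (charFun μ (linearCombinationCLM a z)).re) ∂γ := by
      rw [integral_sub (integrable_const _) h1]; simp
    have e2 : ε + ∫ z, C * ‖linearCombinationCLM (fun j => T (a j)) z‖ ^ 2 ∂γ =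
        ∫ z, (ε + C * ‖linearCombinationCLM (fun j => T (a j)) z‖ ^ 2) ∂γ := by
      rw [integral_add (integrable_const _) (hsq.const_mul _)]; simp
    rw [e1, e2]
    refine integral_mono ((integrable_const _).sub h1)
      ((integrable_const _).add (hsq.const_mul _)) fun z => ?_
    have := hT (linearCombinationCLM a z)
    rwa [hT2] at this
  -- Markov's inequality at level `1/2`. Where the sum is at least `2`, the integrand is at least `1
  -- - e⁻¹ > 1/2`; this is the origin of the factor `2` in the bound.
  have h4 : (1 / 2) * μ.real {h | (1 / 2 : ℝ) ≤ 1 - Real.exp (-(∑ j, ⟪h, a j⟫_ℝ ^ 2) / 2)} ≤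
      ∫ h, (1 - Real.exp (-(∑ j, ⟪h, a j⟫_ℝ ^ 2) / 2)) ∂μ :=
    mul_meas_ge_le_integral_of_nonneg (Eventually.of_forall fun h => sub_nonneg.2 (hle h)) ((integrable_const _).sub hie) _
  have h5 : ∫ h, (1 - Real.exp (-(∑ j, ⟪h, a j⟫_ℝ ^ 2) / 2)) ∂μ =
      1 - ∫ h, Real.exp (-(∑ j, ⟪h, a j⟫_ℝ ^ 2) / 2) ∂μ := by
    rw [integral_sub (integrable_const _) hie]; simp
  have h6 : μ.real {h | 2 ≤ ∑ j, ⟪h, a j⟫_ℝ ^ 2} ≤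
      μ.real {h | (1 / 2 : ℝ) ≤ 1 - Real.exp (-(∑ j, ⟪h, a j⟫_ℝ ^ 2) / 2)} := by
    refine measureReal_mono fun h hh => ?_
    have hh : 2 ≤ ∑ j, ⟪h, a j⟫_ℝ ^ 2 := hh
    have e1 : Real.exp (-(∑ j, ⟪h, a j⟫_ℝ ^ 2) / 2) ≤ Real.exp (-1) :=
      Real.exp_le_exp.2 (by linarith)
    have e2 : Real.exp (-1) < 1 / 2 := by
      have := Real.exp_neg_one_lt_d9; linarith
    change (1 / 2 : ℝ) ≤ _
    linarith
  linarith

end GaussianAverage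

/-! ### Tightness from approximation by compact sets. -/

section Tightness

/-- A family of measures on a complete metric space is tight if up to a small mass it is
concentrated near compact sets. -/
theorem isTightMeasureSet_of_forall_thickening {X : Type*} [MetricSpace X] [CompleteSpace X]
    [MeasurableSpace X] {S : Set (Measure X)}
    (h : ∀ η : ℝ≥0∞, 0 < η → ∀ r : ℝ, 0 < r → ∃ C : Set X, IsCompact C ∧
      ∀ μ ∈ S, μ (Metric.thickening r C)ᶜ ≤ η) : IsTightMeasureSet S := by
  rw [isTightMeasureSet_iff_exists_isCompact_measure_compl_le]
  intro η hη
  -- Mass `δ n` may be lost at scale `1/(n+1)`. The intersection of the closed thickenings is closed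
  -- and totally bounded, hence compact.
  obtain ⟨δ, hδ, hδs⟩ := ENNReal.exists_pos_sum_of_countable' hη.ne' ℕ
  choose C hC hCμ using fun n : ℕ => h (δ n) (hδ n) (1 / ((n : ℝ) + 1)) (by positivity)
  refine ⟨⋂ n : ℕ, Metric.cthickening (1 / ((n : ℝ) + 1)) (C n), ?_, fun μ hμ => ?_⟩
  · refine isCompact_iff_totallyBounded_isComplete.2 ⟨?_,
      (isClosed_iInter fun n => Metric.isClosed_cthickening).isComplete⟩
    rw [Metric.totallyBounded_iff]
    intro ε hε
    obtain ⟨n, hn⟩ := exists_nat_one_div_lt (half_pos hε)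
    obtain ⟨t, htf, ht⟩ := Metric.totallyBounded_iff.1 (hC n).totallyBounded (ε / 2) (half_pos hε)
    refine ⟨t, htf, fun x hx => ?_⟩
    have hx1 := Metric.cthickening_subset_thickening' (half_pos hε) hn (C n) (Set.mem_iInter.1 hx n)
    obtain ⟨c, hc, hxc⟩ := Metric.mem_thickening_iff.1 hx1
    obtain ⟨y, hy, hcy⟩ := Set.mem_iUnion₂.1 (ht hc)
    refine Set.mem_iUnion₂.2 ⟨y, hy, ?_⟩
    rw [Metric.mem_ball] at hcy ⊢
    linarith [dist_triangle x c y]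
  · rw [Set.compl_iInter]
    refine (measure_iUnion_le _).trans (le_trans (ENNReal.tsum_le_tsum fun n => ?_) hδs.le)
    exact (measure_mono (Set.compl_subset_compl.2 (Metric.thickening_subset_cthickening _ _))).trans
      (hCμ n μ hμ)

end Tightness

/-- Continuity gives `ε` inside a ball of radius `δ`; outside it `‖x‖²/δ² ≥ 1` absorbs the global
bound. The quadratic form is what can be averaged over a Gaussian. -/
theorem exists_le_add_mul_norm_sq {E : Type*} [SeminormedAddCommGroup E] {φ : E → ℝ} (hc : ContinuousAt φ 0) (h0 : φ 0 = 0) {M : ℝ}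
    (hM : ∀ x, φ x ≤ M) {ε : ℝ} (hε : 0 < ε) :
    ∃ C : ℝ, 0 ≤ C ∧ ∀ x, φ x ≤ ε + C * ‖x‖ ^ 2 := by
  obtain ⟨δ, hδ, h⟩ := Metric.continuousAt_iff.1 hc ε hε
  refine ⟨|M| / δ ^ 2, by positivity, fun x => ?_⟩
  rcases lt_or_ge ‖x‖ δ with hx | hx
  · have h1 := h (x := x) (by simpa using hx)
    rw [h0, Real.dist_eq, sub_zero] at h1
    have h2 : 0 ≤ |M| / δ ^ 2 * ‖x‖ ^ 2 := by positivity
    linarith [le_abs_self (φ x)]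
  · have h1 : |M| ≤ |M| / δ ^ 2 * ‖x‖ ^ 2 := by
      rw [div_mul_eq_mul_div, le_div_iff₀ (by positivity)]
      gcongr
    linarith [hM x, le_abs_self M]

/-! ### The Minlos–Sazonov theorem. -/

section MinlosSazonov

variable {H K 𝓗 ι : Type*} [NormedAddCommGroup H] [InnerProductSpace ℝ H]
  [NormedAddCommGroup K] [InnerProductSpace ℝ K]

theorem HilbertBasis.hasSum_inner_sq (b : HilbertBasis ι ℝ H) (x : H) :
    HasSum (fun i => ⟪b i, x⟫_ℝ ^ 2) (‖x‖ ^ 2) := by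
  rw [← real_inner_self_eq_norm_sq]
  refine (b.hasSum_inner_mul_inner x x).congr_fun ?_
  intro i
  rw [real_inner_comm, sq]

/-- The partial sums of the expansion in an orthonormal basis, as linear maps. -/
noncomputable def HilbertBasis.partialSum (f : HilbertBasis ι ℝ K) (A : Finset ι) : K →ₗ[ℝ] K :=
  ∑ j ∈ A, (innerₗ K (f j)).smulRight (f j)

theorem HilbertBasis.partialSum_apply (f : HilbertBasis ι ℝ K) (A : Finset ι) (y : K) :
    f.partialSum A y = ∑ j ∈ A, ⟪y, f j⟫_ℝ • f j := by
  simp [HilbertBasis.partialSum, real_inner_comm]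

theorem HilbertBasis.tendsto_partialSum (f : HilbertBasis ι ℝ K) (y : K) :
    Tendsto (fun A => f.partialSum A y) atTop (𝓝 y) := by
  have := f.hasSum_repr y
  simp only [f.repr_apply_apply] at this
  refine Tendsto.congr (fun A => ?_) this
  rw [f.partialSum_apply]
  exact Finset.sum_congr rfl fun j _ => by rw [real_inner_comm]

theorem HilbertBasis.partialSum_self [DecidableEq ι] (f : HilbertBasis ι ℝ K) (A : Finset ι)
    (i : ι) : f.partialSum A (f i) = if i ∈ A then f i else 0 := by
  rw [f.partialSum_apply]
  simp [orthonormal_iff_ite.1 f.orthonormal]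

theorem HilbertBasis.norm_sum_smul_sq (f : HilbertBasis ι ℝ K) (A : Finset ι) (c : ι → ℝ) :
    ‖∑ j ∈ A, c j • f j‖ ^ 2 = ∑ j ∈ A, c j ^ 2 := by
  rw [← real_inner_self_eq_norm_sq, f.orthonormal.inner_sum]
  exact Finset.sum_congr rfl fun j _ => by simp [sq]

variable [CompleteSpace K]

/-- The nonnegative double series `∑ ⟪f j, J (b i)⟫²` may be summed in either order: over `j` first
it gives `‖J (b i)‖²`, over `i` first `‖J* (f j)‖²`. -/
theorem IsHilbertSchmidt.summable_adjoint [CompleteSpace H] {J : H →L[ℝ] K} (hJ : IsHilbertSchmidt J)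
    (f : HilbertBasis ι ℝ K) :
    Summable fun j => ‖ContinuousLinearMap.adjoint J (f j)‖ ^ 2 := by
  obtain ⟨s, b, hb⟩ := hJ
  have h1 : Summable fun p : s × ι => ⟪f p.2, J (b p.1)⟫_ℝ ^ 2 := by
    rw [summable_prod_of_nonneg fun p => sq_nonneg _]
    refine ⟨fun i => (f.hasSum_inner_sq (J (b i))).summable, ?_⟩
    simpa only [fun i => (f.hasSum_inner_sq (J (b i))).tsum_eq] using hb
  have h2 := (summable_prod_of_nonneg (f := fun p : ι × s => ⟪f p.1, J (b p.2)⟫_ℝ ^ 2)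
    fun p => sq_nonneg _).1 ((Equiv.prodComm ι s).summable_iff.2 h1)
  refine h2.2.congr fun j => ?_
  rw [← (b.hasSum_inner_sq (ContinuousLinearMap.adjoint J (f j))).tsum_eq]
  refine tsum_congr fun i => ?_
  rw [ContinuousLinearMap.adjoint_inner_right, real_inner_comm]

variable [MeasurableSpace K]

/-- A uniform quadratic tail bound implies tightness of a family of finite-dimensional measures. -/
theorem isTightMeasureSet_of_tail_bound (f : HilbertBasis ι ℝ K)
    {q : ι → ℝ} (hq0 : ∀ j, 0 ≤ q j) (hq : Summable q) (μ : Finset ι → Measure K)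
    [∀ A, IsFiniteMeasure (μ A)]
    (hsupp : ∀ A, ∀ᵐ h ∂(μ A), f.partialSum A h = h)
    (htail : ∀ ε : ℝ, 0 < ε → ∃ C : ℝ, 0 ≤ C ∧ ∀ (A D : Finset ι) (t : ℝ), 0 ≤ t →
      (μ A).real {h | 2 ≤ t * ∑ j ∈ D, ⟪h, f j⟫_ℝ ^ 2} ≤ 2 * (ε + C * (t * ∑ j ∈ D, q j))) :
    IsTightMeasureSet (Set.range μ) := by
  classical
  refine isTightMeasureSet_of_forall_thickening fun η hη r hr => ?_
  obtain ⟨e, he, heη⟩ : ∃ e : ℝ, 0 < e ∧ ENNReal.ofReal e ≤ η := by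
    rcases eq_or_ne η ⊤ with rfl | hη'
    · exact ⟨1, one_pos, le_top⟩
    · exact ⟨η.toReal, ENNReal.toReal_pos hη.ne' hη', (ENNReal.ofReal_toReal hη').le⟩
  obtain ⟨C, hC, htail⟩ := htail (e / 8) (by positivity)
  -- With this `t` the tail event says that the squared norm of the component outside `B` is at
  -- least `r²`. The finite set `B` is taken so large that `C * t` times the remaining sum of `q` is
  -- at most `e/8`.
  set t := 2 / r ^ 2 with ht
  have htpos : 0 < t := by positivity
  obtain ⟨B, hB⟩ := summable_iff_vanishing_norm.1 hq (e / (8 * (C * t + 1))) (by positivity)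
  -- Chosen so that `C * t' * ∑' j, q j ≤ e/8`. Each of the two bad events then has mass at most `2
  -- * (e/8 + e/8) = e/2`.
  set t' := e / (8 * (C * (∑' j, q j) + 1)) with ht'
  have hQ : 0 ≤ ∑' j, q j := tsum_nonneg hq0
  have ht'pos : 0 < t' := by positivity
  refine ⟨linearCombinationCLM (fun j : B => f j) '' Metric.closedBall 0 √(2 / t'),
    (isCompact_closedBall _ _).image (ContinuousLinearMap.continuous _), ?_⟩
  rintro _ ⟨A, rfl⟩
  have h1 : (μ A).real {h | 2 ≤ t * ∑ j ∈ A \ B, ⟪h, f j⟫_ℝ ^ 2} ≤ e / 2 := by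
    refine (htail A (A \ B) t htpos.le).trans ?_
    have h2 := hB (A \ B) Finset.sdiff_disjoint
    rw [Real.norm_of_nonneg (Finset.sum_nonneg fun j _ => hq0 j), lt_div_iff₀ (by positivity)] at h2
    have h3 : 0 ≤ ∑ j ∈ A \ B, q j := Finset.sum_nonneg fun j _ => hq0 j
    nlinarith
  have h2 : (μ A).real {h | 2 ≤ t' * ∑ j ∈ B, ⟪h, f j⟫_ℝ ^ 2} ≤ e / 2 := by
    refine (htail A B t' ht'pos.le).trans ?_
    have h3 : ∑ j ∈ B, q j ≤ ∑' j, q j := hq.sum_le_tsum B fun j _ => hq0 j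
    have h4 : t' * (8 * (C * (∑' j, q j) + 1)) = e := by rw [ht']; field_simp
    have h5 : C * (t' * ∑ j ∈ B, q j) ≤ C * (t' * ∑' j, q j) := by gcongr
    nlinarith
  have h3 : (μ A) {h | 2 ≤ t * ∑ j ∈ A \ B, ⟪h, f j⟫_ℝ ^ 2} ≤ ENNReal.ofReal (e / 2) := by
    rw [← ofReal_measureReal]; exact ENNReal.ofReal_le_ofReal h1
  have h4 : (μ A) {h | 2 ≤ t' * ∑ j ∈ B, ⟪h, f j⟫_ℝ ^ 2} ≤ ENNReal.ofReal (e / 2) := by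
    rw [← ofReal_measureReal]; exact ENNReal.ofReal_le_ofReal h2
  refine le_trans ?_ heη
  refine le_trans (b := μ A ({h | 2 ≤ t * ∑ j ∈ A \ B, ⟪h, f j⟫_ℝ ^ 2} ∪
    {h | 2 ≤ t' * ∑ j ∈ B, ⟪h, f j⟫_ℝ ^ 2})) (measure_mono_ae ?_) ?_
  · filter_upwards [hsupp A] with h hh hmem
    by_contra hcon
    have hcon' : ¬ (2 ≤ t * ∑ j ∈ A \ B, ⟪h, f j⟫_ℝ ^ 2 ∨ 2 ≤ t' * ∑ j ∈ B, ⟪h, f j⟫_ℝ ^ 2) := hcon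
    rw [not_or, not_le, not_le] at hcon'
    obtain ⟨hc1, hc2⟩ := hcon'
    -- Off both events, the projection of `h` to the span of `B` lies in the compact ball and is at
    -- distance less than `r` from `h`.
    refine hmem (Metric.mem_thickening_iff.2 ⟨_, ⟨innerCoordinates (fun j : B => f j) h, ?_, rfl⟩, ?_⟩)
    · rw [mem_closedBall_zero_iff]
      refine Real.le_sqrt_of_sq_le ?_
      rw [norm_innerCoordinates_sq, Finset.sum_coe_sort B (fun j => ⟪h, f j⟫_ℝ ^ 2),
        le_div_iff₀ ht'pos]
      linarith
    · have e1 : linearCombinationCLM (fun j : B => f j) (innerCoordinates (fun j : B => f j) h) =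
          ∑ j ∈ B, ⟪h, f j⟫_ℝ • f j := by
        rw [linearCombinationCLM_apply]
        exact Finset.sum_coe_sort B (fun j => ⟪h, f j⟫_ℝ • f j)
      have e2 : ∀ j, j ∉ A → ⟪h, f j⟫_ℝ = 0 := by
        intro j hj
        rw [← hh, f.partialSum_apply, sum_inner]
        refine Finset.sum_eq_zero fun i hi => ?_
        rw [real_inner_smul_left, orthonormal_iff_ite.1 f.orthonormal, if_neg, mul_zero]
        rintro rfl
        exact hj hi
      have e3 : ∑ j ∈ B, ⟪h, f j⟫_ℝ • f j = ∑ j ∈ A ∩ B, ⟪h, f j⟫_ℝ • f j := by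
        refine (Finset.sum_subset Finset.inter_subset_right fun j hj hj' => ?_).symm
        rw [e2 j fun hA => hj' (Finset.mem_inter.2 ⟨hA, hj⟩), zero_smul]
      have e4 : h - ∑ j ∈ B, ⟪h, f j⟫_ℝ • f j = ∑ j ∈ A \ B, ⟪h, f j⟫_ℝ • f j := by
        have e5 : h = ∑ j ∈ A, ⟪h, f j⟫_ℝ • f j := by rw [← f.partialSum_apply, hh]
        rw [e3, sub_eq_iff_eq_add, add_comm, Finset.sum_inter_add_sum_sdiff A B]
        exact e5
      rw [dist_eq_norm, e1, e4]
      refine lt_of_pow_lt_pow_left₀ 2 hr.le ?_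
      rw [f.norm_sum_smul_sq]
      have : t * r ^ 2 = 2 := by rw [ht]; field_simp
      nlinarith
  · refine (measure_union_le _ _).trans ((add_le_add h3 h4).trans ?_)
    rw [← ENNReal.ofReal_add (by positivity) (by positivity), add_halves]

variable [CompleteSpace H] [BorelSpace K] [NormedAddCommGroup 𝓗] [InnerProductSpace ℂ 𝓗] [CompleteSpace 𝓗]

/-- **Minlos–Sazonov theorem** for the matrix coefficient of a unitary representation: along a
Hilbert–Schmidt operator it is the characteristic function of a measure. -/
theorem exists_charFun_eq_inner_adjoint {J : H →L[ℝ] K} (hJ : IsHilbertSchmidt J)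
    (π : Multiplicative H →* (𝓗 ≃ₗᵢ[ℂ] 𝓗))
    (hπ : ∀ x : 𝓗, Continuous fun g : H => π (Multiplicative.ofAdd g) x)
    (v : 𝓗) (hv : ‖v‖ = 1) :
    ∃ μ : Measure K, IsProbabilityMeasure μ ∧ ∀ y, charFun μ y =
      ⟪v, π (Multiplicative.ofAdd (ContinuousLinearMap.adjoint J y)) v⟫_ℂ := by
  classical
  obtain ⟨w, f, -⟩ := exists_hilbertBasis ℝ K
  set Jt := ContinuousLinearMap.adjoint J with hJt
  let χ : H → ℂ := fun g => ⟪v, π (Multiplicative.ofAdd g) v⟫_ℂ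
  have hχc : Continuous χ := by have := hπ v; fun_prop
  have hχ0 : χ 0 = 1 := by
    simp only [χ, ofAdd_zero, map_one, LinearIsometryEquiv.coe_one, id]
    rw [inner_self_eq_norm_sq_to_K, hv]; simp
  have hχ1 : ∀ g, ‖χ g‖ ≤ 1 := fun g => by
    refine (norm_inner_le_norm _ _).trans ?_
    rw [LinearIsometryEquiv.norm_map, hv, one_mul]
  have hm : ∀ A : Finset w, ∃ m : ProbabilityMeasure (EuclideanSpace ℝ A), ∀ u,
      charFun (m : Measure (EuclideanSpace ℝ A)) u =
        χ (Jt (linearCombinationCLM (fun j : A => f j) u)) := by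
    intro A
    refine exists_probabilityMeasure_charFun_eq_inner (fun z => (π (Multiplicative.ofAdd
      (Jt (linearCombinationCLM (fun j : A => f j) z)))).toLinearIsometry) ?_ ?_ v hv
    · intro x y z
      simp only [map_add, ofAdd_add, map_mul, LinearIsometryEquiv.coe_toLinearIsometry,
        LinearIsometryEquiv.coe_mul, Function.comp_apply]
    · intro z
      exact (hπ z).comp (Jt.continuous.comp (ContinuousLinearMap.continuous _))
  choose m hm using hm
  let μ : Finset w → ProbabilityMeasure K := fun A =>
    (m A).map (f := linearCombinationCLM (fun j : A => f j))
      (ContinuousLinearMap.continuous _).aemeasurable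
  have hμ : ∀ A, (μ A : Measure K) = (m A : Measure (EuclideanSpace ℝ A)).map
      (linearCombinationCLM (fun j : A => f j)) := fun A => rfl
  have hcoord : ∀ (A : Finset w) (y : K), linearCombinationCLM (fun j : A => f j)
      (innerCoordinates (fun j : A => f j) y) = f.partialSum A y := by
    intro A y
    rw [linearCombinationCLM_apply, f.partialSum_apply]
    exact Finset.sum_coe_sort A (fun j => ⟪y, f j⟫_ℝ • f j)
  have hchar : ∀ A y, charFun (μ A : Measure K) y = χ (Jt (f.partialSum A y)) := by
    intro A y
    rw [hμ, charFun_apply, integral_map (ContinuousLinearMap.continuous _).aemeasurable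
      (Continuous.aestronglyMeasurable (by fun_prop))]
    simp_rw [inner_linearCombinationCLM]
    rw [← charFun_apply, hm, hcoord]
  have htight : IsTightMeasureSet (Set.range fun A => (μ A : Measure K)) := by
    refine isTightMeasureSet_of_tail_bound f (fun j => by positivity) (hJ.summable_adjoint f) _
      (fun A => ?_) (fun ε hε => ?_)
    · rw [hμ, ae_map_iff (ContinuousLinearMap.continuous _).aemeasurable]
      · refine Eventually.of_forall fun z => ?_
        rw [linearCombinationCLM_apply, map_sum]
        refine Finset.sum_congr rfl fun j _ => ?_
        rw [map_smul, f.partialSum_self, if_pos j.2]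
      · refine (isClosed_eq ?_ continuous_id).measurableSet
        refine Continuous.congr (f := fun y => ∑ j ∈ A, ⟪y, f j⟫_ℝ • f j) (by fun_prop) fun y => ?_
        rw [f.partialSum_apply]
    · obtain ⟨C, hC, hb⟩ := exists_le_add_mul_norm_sq (φ := fun g => 1 - (χ g).re)
        (by fun_prop) (by simp [hχ0]) (M := 2) (fun g => by
          have := (Complex.abs_re_le_norm (χ g)).trans (hχ1 g)
          rw [abs_le] at this
          linarith) hε
      refine ⟨C, hC, fun A D t ht => ?_⟩
      -- Scaling the vectors by `√t` produces the factor `t` in the tail event. The truncation to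
      -- `A` fixes or kills each `f j`, so the bound is uniform in `A`.
      have h1 := measureReal_two_le_sum_sq_le (μ A : Measure K)
        ((Jt : K →ₗ[ℝ] H) ∘ₗ f.partialSum A) (ε := ε) (C := C) (fun y => by
          rw [hchar]; exact hb _) (fun j : D => √t • f j)
      have h2 : ∀ h : K, ∑ j : D, ⟪h, √t • f j⟫_ℝ ^ 2 = t * ∑ j ∈ D, ⟪h, f j⟫_ℝ ^ 2 := by
        intro h
        rw [← Finset.sum_coe_sort D, Finset.mul_sum]
        refine Finset.sum_congr rfl fun j _ => ?_
        rw [real_inner_smul_right, mul_pow, Real.sq_sqrt ht]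
      simp_rw [h2] at h1
      refine h1.trans ?_
      gcongr
      rw [← Finset.sum_coe_sort D, Finset.mul_sum]
      refine Finset.sum_le_sum fun j _ => ?_
      rw [LinearMap.comp_apply, map_smul, f.partialSum_self, map_smul, norm_smul, mul_pow,
        Real.norm_of_nonneg (Real.sqrt_nonneg t), Real.sq_sqrt ht]
      split_ifs
      · rfl
      · simp only [map_zero, norm_zero, ne_eq, OfNat.ofNat_ne_zero, not_false_eq_true, zero_pow,
          mul_zero]
        positivity
  obtain ⟨ν, hν⟩ := exists_charFun_eq_of_isTightMeasureSet (μ := μ) (l := atTop)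
    (f := fun y => χ (Jt y)) (by convert htight using 1; ext; simp) (fun y => by
      simp_rw [hchar]
      exact ((hχc.comp Jt.continuous).tendsto y).comp (f.tendsto_partialSum y))
  exact ⟨ν, inferInstance, hν⟩

end MinlosSazonov

/-! ### Convergence in measure. -/

section InMeasure

variable {α : Type*} [MeasurableSpace α] {μ : Measure α}

theorem tendstoInMeasure_of_forall_eventually_le {f : ℕ → α → ℝ} {g : α → ℝ}
    (h : ∀ ε : ℝ, 0 < ε → ∀ᶠ n in atTop, μ {x | ε ≤ ‖f n x - g x‖} ≤ ENNReal.ofReal ε) :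
    TendstoInMeasure μ f atTop g := by
  rw [tendstoInMeasure_iff_norm]
  intro ε hε
  rw [ENNReal.tendsto_nhds_zero]
  intro η hη
  obtain ⟨e, he, heη⟩ : ∃ e : ℝ, 0 < e ∧ ENNReal.ofReal e ≤ η := by
    rcases eq_or_ne η ⊤ with rfl | hη'
    · exact ⟨1, one_pos, le_top⟩
    · exact ⟨η.toReal, ENNReal.toReal_pos hη.ne' hη', (ENNReal.ofReal_toReal hη').le⟩
  filter_upwards [h (min ε e) (lt_min hε he)] with n hn
  refine (measure_mono fun x hx => ?_).trans (hn.trans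
    ((ENNReal.ofReal_le_ofReal (min_le_right _ _)).trans heη))
  exact (min_le_left ε e).trans hx

/-- On a finite measure space, convergence in measure means that every subsequence has an almost
everywhere convergent subsequence, and that criterion is additive. -/
theorem MeasureTheory.TendstoInMeasure.add_of_ae [IsFiniteMeasure μ] {f f' : ℕ → α → ℝ}
    {g g' : α → ℝ} (hf : ∀ n, AEStronglyMeasurable (f n) μ)
    (hf' : ∀ n, AEStronglyMeasurable (f' n) μ)
    (h : TendstoInMeasure μ f atTop g)
    (h' : ∀ᵐ x ∂μ, Tendsto (fun n => f' n x) atTop (𝓝 (g' x))) :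
    TendstoInMeasure μ (fun n x => f n x + f' n x) atTop (fun x => g x + g' x) := by
  refine (exists_seq_tendstoInMeasure_atTop_iff (f := fun n x => f n x + f' n x)
    fun n => (hf n).add (hf' n)).2 ?_
  intro ns hns
  obtain ⟨ns', hns', hlim⟩ := (exists_seq_tendstoInMeasure_atTop_iff hf).1 h ns hns
  refine ⟨ns', hns', ?_⟩
  filter_upwards [hlim, h'] with x hx hx'
  exact hx.add (hx'.comp (hns.comp hns').tendsto_atTop)

end InMeasure

/-! ### Construction of the pairing. -/

section MeasurablePairing

variable {H K : Type*} [NormedAddCommGroup H] [InnerProductSpace ℝ H]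
  [NormedAddCommGroup K] [InnerProductSpace ℝ K]

/-- The orthogonal complement of the range of `J*` is the kernel of `J`, which is zero. -/
theorem IsNuclearExtension.denseRange_adjoint [CompleteSpace H] [CompleteSpace K]
    {J : H →L[ℝ] K} (hJ : IsNuclearExtension J) :
    DenseRange (ContinuousLinearMap.adjoint J) := by
  have h : (LinearMap.range (ContinuousLinearMap.adjoint J : K →ₗ[ℝ] H)).topologicalClosure = ⊤ := by
    rw [Submodule.topologicalClosure_eq_top_iff, Submodule.eq_bot_iff]
    intro x hx
    refine hJ.injective ?_
    rw [map_zero, ← inner_self_eq_zero (𝕜 := ℝ), ← ContinuousLinearMap.adjoint_inner_left]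
    exact (Submodule.mem_orthogonal _ _).1 hx _ ⟨_, rfl⟩
  have h2 := (Submodule.dense_iff_topologicalClosure_eq_top).2 h
  rw [LinearMap.coe_range] at h2
  exact h2

variable [MeasurableSpace K]

/-- The points where `⟪h, y n⟫` converges form a subspace, and the limit is linear on it. -/
theorem isLinearMeasurableFunctional_of_ae_tendsto {μ : Measure K} {y : ℕ → K} {X : K →ₘ[μ] ℝ}
    (h : ∀ᵐ h ∂μ, Tendsto (fun n => ⟪h, y n⟫_ℝ) atTop (𝓝 (X h))) :
    IsLinearMeasurableFunctional X := by
  let L : Submodule ℝ K :=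
    { carrier := {h | ∃ c, Tendsto (fun n => ⟪h, y n⟫_ℝ) atTop (𝓝 c)}
      add_mem' := by
        rintro a b ⟨c, hc⟩ ⟨d, hd⟩
        exact ⟨c + d, by simpa only [inner_add_left] using hc.add hd⟩
      zero_mem' := ⟨0, by simp⟩
      smul_mem' := by
        rintro r a ⟨c, hc⟩
        exact ⟨r * c, by simpa only [real_inner_smul_left] using hc.const_mul r⟩ }
  have hL : ∀ x : L, Tendsto (fun n => ⟪(x : K), y n⟫_ℝ) atTop (𝓝 x.2.choose) :=
    fun x => x.2.choose_spec
  let l : L →ₗ[ℝ] ℝ :=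
    { toFun := fun x => x.2.choose
      map_add' := fun a b => tendsto_nhds_unique (hL (a + b))
        (by simpa only [Submodule.coe_add, inner_add_left] using (hL a).add (hL b))
      map_smul' := fun r a => tendsto_nhds_unique (hL (r • a))
        (by simpa only [Submodule.coe_smul, real_inner_smul_left, RingHom.id_apply,
          smul_eq_mul] using (hL a).const_mul r) }
  refine ⟨L, l, ?_, ?_⟩
  · rw [← mem_ae_iff]
    filter_upwards [h] with x hx
    exact ⟨_, hx⟩
  · filter_upwards [h] with x hx hxL
    exact tendsto_nhds_unique hx (hL ⟨x, hxL⟩)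

variable [BorelSpace K]

/-- If `μ̂ (y) = φ (T y)` with `φ` continuous at the origin, then the functional `⟪·, y⟫` is small
in measure when `T y` is small. -/
theorem exists_measure_inner_le (μ : Measure K) [IsFiniteMeasure μ]
    {T : K →L[ℝ] H} {φ : H → ℂ} (hφ : ContinuousAt φ 0) (hμ : ∀ y, charFun μ y = φ (T y))
    {ε : ℝ} (hε : 0 < ε) :
    ∃ δ : ℝ, 0 < δ ∧ ∀ y, ‖T y‖ < δ → μ {h | ε ≤ ‖⟪h, y⟫_ℝ‖} ≤ ENNReal.ofReal ε := by
  rcases eq_or_ne μ 0 with rfl | hμ0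
  · exact ⟨1, one_pos, fun y _ => by simp⟩
  have : NeZero μ := ⟨hμ0⟩
  set c := μ Set.univ with hc
  have hc0 : c ≠ 0 := by simpa [hc] using hμ0
  have hct : c ≠ ⊤ := measure_ne_top _ _
  have hcr : 0 < c.toReal := ENNReal.toReal_pos hc0 hct
  set m : Measure K := c⁻¹ • μ with hm
  have hmp : IsProbabilityMeasure m := isProbabilityMeasureSMul
  have hmchar : ∀ y, charFun m y = (c.toReal⁻¹ : ℝ) • φ (T y) := by
    intro y
    rw [← hμ, hm, charFun_apply, integral_smul_measure, charFun_apply, ENNReal.toReal_inv]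
  have hμm : ∀ s, μ s = c * m s := by
    intro s
    rw [hm, Measure.smul_apply, smul_eq_mul, ← mul_assoc, ENNReal.mul_inv_cancel hc0 hct, one_mul]
  -- the bound on `1 - Re` of the characteristic function
  have hbnd : ∃ C : ℝ, 0 ≤ C ∧ ∀ y, 1 - (charFun m y).re ≤ ε / (4 * c.toReal) + C * ‖T y‖ ^ 2 := by
    obtain ⟨δ, hδ, h⟩ := Metric.continuousAt_iff.1
      (show ContinuousAt (fun x => 1 - c.toReal⁻¹ * (φ x).re) 0 from
        ((Complex.continuous_re.continuousAt.comp hφ).const_mul _).const_sub 1) (ε / (4 * c.toReal)) (by positivity)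
    have hre : ∀ y, (charFun m y).re = c.toReal⁻¹ * (φ (T y)).re := fun y => by
      rw [hmchar, Complex.smul_re, smul_eq_mul]
    have h0 : 1 - c.toReal⁻¹ * (φ 0).re = 0 := by
      rw [← T.map_zero, ← hre]; simp
    refine ⟨2 / δ ^ 2, by positivity, fun y => ?_⟩
    have hp : 0 < ε / (4 * c.toReal) := by positivity
    rcases lt_or_ge ‖T y‖ δ with hx | hx
    · have h1 := h (x := T y) (by simpa using hx)
      rw [h0, Real.dist_eq, sub_zero, ← hre] at h1
      have h2 : 0 ≤ 2 / δ ^ 2 * ‖T y‖ ^ 2 := by positivity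
      linarith [le_abs_self (1 - (charFun m y).re)]
    · have h1 : 2 ≤ 2 / δ ^ 2 * ‖T y‖ ^ 2 := by
        rw [div_mul_eq_mul_div, le_div_iff₀ (by positivity)]
        gcongr
      have h2 := (Complex.abs_re_le_norm (charFun m y)).trans (norm_charFun_le_one y)
      rw [abs_le] at h2
      linarith
  obtain ⟨C, hC, hb⟩ := hbnd
  set t := 2 / ε ^ 2 with ht
  have htp : 0 < t := by positivity
  -- The radius makes `2 * c * C * t * ‖T y‖² ≤ ε/2`; the constant term contributes the other `ε/2`.
  -- The tail estimate is applied to a single vector.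
  refine ⟨√(ε / (4 * c.toReal * (C * t + 1))), Real.sqrt_pos.2 (by positivity), fun y hy => ?_⟩
  have h1 := measureReal_two_le_sum_sq_le m (T : K →ₗ[ℝ] H) hb (fun _ : Unit => √t • y)
  simp only [Finset.univ_unique, Finset.sum_const, Finset.card_singleton, one_smul, map_smul,
    norm_smul, real_inner_smul_right, mul_pow, Real.sq_sqrt htp.le,
    Real.norm_of_nonneg (Real.sqrt_nonneg t)] at h1
  have h2 : {h : K | ε ≤ ‖⟪h, y⟫_ℝ‖} ⊆ {h : K | 2 ≤ t * ⟪h, y⟫_ℝ ^ 2} := by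
    intro h hh
    have hh : ε ≤ ‖⟪h, y⟫_ℝ‖ := hh
    have : ε ^ 2 ≤ ⟪h, y⟫_ℝ ^ 2 := by
      rw [← sq_abs ⟪h, y⟫_ℝ, ← Real.norm_eq_abs]
      gcongr
    change 2 ≤ t * ⟪h, y⟫_ℝ ^ 2
    rw [ht, div_mul_eq_mul_div, le_div_iff₀ (by positivity)]
    gcongr
  have h3 : ‖T y‖ ^ 2 * (4 * c.toReal * (C * t + 1)) < ε := by
    have := Real.lt_sqrt (norm_nonneg _) |>.1 hy
    rwa [lt_div_iff₀ (by positivity)] at this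
  have h4 : c.toReal * (2 * (ε / (4 * c.toReal) + C * (t * ‖T y‖ ^ 2))) ≤ ε := by
    have e1 : c.toReal * (ε / (4 * c.toReal)) = ε / 4 := by field_simp
    have e2 : 0 ≤ c.toReal * ‖T y‖ ^ 2 := by positivity
    nlinarith
  rw [hμm]
  calc c * m {h : K | ε ≤ ‖⟪h, y⟫_ℝ‖} ≤ c * m {h : K | 2 ≤ t * ⟪h, y⟫_ℝ ^ 2} := by
        gcongr
    _ = ENNReal.ofReal (c.toReal * m.real {h : K | 2 ≤ t * ⟪h, y⟫_ℝ ^ 2}) := by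
        rw [ENNReal.ofReal_mul hcr.le, ENNReal.ofReal_toReal hct, ofReal_measureReal]
    _ ≤ ENNReal.ofReal ε := by
        refine ENNReal.ofReal_le_ofReal (le_trans ?_ h4)
        gcongr
        exact h1

/-- For every `g` there are `y n` with `T (y n) → g` such that `⟪·, y n⟫` converges a.e. -/
theorem exists_ae_tendsto_inner {μ : Measure K} [IsFiniteMeasure μ] {T : K →L[ℝ] H}
    (hT : DenseRange T)
    (hμ : ∀ ε : ℝ, 0 < ε → ∃ δ : ℝ, 0 < δ ∧ ∀ y, ‖T y‖ < δ →
      μ {h | ε ≤ ‖⟪h, y⟫_ℝ‖} ≤ ENNReal.ofReal ε) (g : H) :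
    ∃ (y : ℕ → K) (X : K →ₘ[μ] ℝ), Tendsto (fun n => T (y n)) atTop (𝓝 g) ∧
      ∀ᵐ h ∂μ, Tendsto (fun n => ⟪h, y n⟫_ℝ) atTop (𝓝 (X h)) := by
  choose δ hδ hδμ using fun n : ℕ => hμ ((1 / 2 : ℝ) ^ n) (by positivity)
  -- Both `δ n` and `δ (n - 1)` enter so that `y n` and `y (n + 1)` are each within `δ n / 2` of `g`
  -- under `T`. At `n = 0` the truncated `n - 1` only repeats `δ 0`.
  have hy : ∀ n : ℕ, ∃ y, ‖T y - g‖ < min (1 / ((n : ℝ) + 1)) (min (δ n) (δ (n - 1)) / 2) := by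
    intro n
    have hpos : 0 < min (1 / ((n : ℝ) + 1)) (min (δ n) (δ (n - 1)) / 2) :=
      lt_min (by positivity) (half_pos (lt_min (hδ _) (hδ _)))
    obtain ⟨y, hy⟩ := hT.exists_dist_lt g hpos
    exact ⟨y, by rwa [dist_comm, dist_eq_norm] at hy⟩
  choose y hy using hy
  have hlim : Tendsto (fun n => T (y n)) atTop (𝓝 g) := by
    rw [tendsto_iff_norm_sub_tendsto_zero]
    exact squeeze_zero (fun _ => norm_nonneg _) (fun n => ((hy n).trans_le (min_le_left _ _)).le)
      tendsto_one_div_add_atTop_nhds_zero_nat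
  have hdiff : ∀ n, μ {h | (1 / 2 : ℝ) ^ n ≤ ‖⟪h, y n - y (n + 1)⟫_ℝ‖} ≤
      ENNReal.ofReal ((1 / 2 : ℝ) ^ n) := by
    intro n
    refine hδμ n _ ?_
    have h1 := (hy n).trans_le ((min_le_right _ _).trans
      (div_le_div_of_nonneg_right (min_le_left _ _) two_pos.le))
    have h2 := (hy (n + 1)).trans_le ((min_le_right _ _).trans
      (div_le_div_of_nonneg_right (min_le_right _ _) two_pos.le))
    rw [Nat.add_sub_cancel] at h2
    calc ‖T (y n - y (n + 1))‖ = ‖(T (y n) - g) - (T (y (n + 1)) - g)‖ := by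
          rw [map_sub]; congr 1; abel
      _ ≤ ‖T (y n) - g‖ + ‖T (y (n + 1)) - g‖ := norm_sub_le _ _
      _ < δ n := by linarith
  have hsum : ∑' n, μ {h | (1 / 2 : ℝ) ^ n ≤ ‖⟪h, y n - y (n + 1)⟫_ℝ‖} ≠ ⊤ := by
    refine ne_top_of_le_ne_top ?_ (ENNReal.tsum_le_tsum hdiff)
    rw [← ENNReal.ofReal_tsum_of_nonneg (fun n => by positivity) summable_geometric_two]
    exact ENNReal.ofReal_ne_top
  -- Borel–Cantelli: almost everywhere the increments are eventually below `2⁻ⁿ`.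
  have hconv : ∀ᵐ h ∂μ, ∃ l, Tendsto (fun n => ⟪h, y n⟫_ℝ) atTop (𝓝 l) := by
    filter_upwards [ae_eventually_notMem hsum] with h hh
    refine cauchySeq_tendsto_of_complete (cauchySeq_of_summable_dist ?_)
    refine Summable.of_norm_bounded_eventually_nat (summable_geometric_two) ?_
    filter_upwards [hh] with n hn
    have hn : ¬(1 / 2 : ℝ) ^ n ≤ ‖⟪h, y n - y (n + 1)⟫_ℝ‖ := hn
    rw [not_le] at hn
    rw [dist_eq_norm, norm_norm, ← inner_sub_right]
    exact hn.le
  obtain ⟨X, hX, hXlim⟩ := measurable_limit_of_tendsto_metrizable_ae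
    (fun n => (by fun_prop : Continuous fun h : K => ⟪h, y n⟫_ℝ).aemeasurable) hconv
  refine ⟨y, AEEqFun.mk X hX.aestronglyMeasurable, hlim, ?_⟩
  filter_upwards [hXlim, AEEqFun.coeFn_mk X hX.aestronglyMeasurable] with h h1 h2
  rwa [h2]

/-- Approximation data for a pairing: `Φ g` is the limit of `⟪·, y n⟫` for suitable `y n` with
`T (y n) → g`. -/
theorem exists_linearMap_ae_tendsto {μ : Measure K} [IsFiniteMeasure μ] {T : K →L[ℝ] H}
    (hT : DenseRange T)
    (hμ : ∀ ε : ℝ, 0 < ε → ∃ δ : ℝ, 0 < δ ∧ ∀ y, ‖T y‖ < δ →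
      μ {h | ε ≤ ‖⟪h, y⟫_ℝ‖} ≤ ENNReal.ofReal ε) :
    ∃ Φ : H →ₗ[ℝ] (K →ₘ[μ] ℝ),
      (∀ g, ∃ y : ℕ → K, Tendsto (fun n => T (y n)) atTop (𝓝 g) ∧
        ∀ᵐ h ∂μ, Tendsto (fun n => ⟪h, y n⟫_ℝ) atTop (𝓝 (Φ g h))) ∧
      ∀ (g : H) (z : ℕ → K), Tendsto (fun n => T (z n)) atTop (𝓝 g) →
        TendstoInMeasure μ (fun n h => ⟪h, z n⟫_ℝ) atTop (Φ g) := by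
  choose y X hy hX using exists_ae_tendsto_inner hT hμ
  have hmeas : ∀ z : K, AEStronglyMeasurable (fun h : K => ⟪h, z⟫_ℝ) μ := fun z =>
    (by fun_prop : Continuous fun h : K => ⟪h, z⟫_ℝ).aestronglyMeasurable
  -- The limit depends only on `g`, since `T (z n - y g n) → 0` forces the difference to vanish in
  -- measure. Linearity of the pairing follows from this independence.
  have hall : ∀ (g : H) (z : ℕ → K), Tendsto (fun n => T (z n)) atTop (𝓝 g) →
      TendstoInMeasure μ (fun n h => ⟪h, z n⟫_ℝ) atTop (X g) := by
    intro g z hz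
    have h1 : TendstoInMeasure μ (fun n h => ⟪h, z n - y g n⟫_ℝ) atTop (fun _ => (0 : ℝ)) := by
      refine tendstoInMeasure_of_forall_eventually_le fun ε hε => ?_
      obtain ⟨δ, hδ, hδμ⟩ := hμ ε hε
      have h2 : Tendsto (fun n => ‖T (z n - y g n)‖) atTop (𝓝 0) := by
        have := (hz.sub (hy g)).norm
        simpa only [map_sub, sub_self, norm_zero] using this
      filter_upwards [h2.eventually (gt_mem_nhds hδ)] with n hn
      simpa only [sub_zero] using hδμ _ hn
    have h2 := h1.add_of_ae (fun n => hmeas _) (fun n => hmeas _) (hX g)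
    refine (h2.congr_left fun n => ?_).congr_right ?_
    · exact Eventually.of_forall fun h => by
        simp only [inner_sub_right, sub_add_cancel]
    · exact Eventually.of_forall fun h => by simp only [zero_add]
  have hae : ∀ (g : H) (Y : K →ₘ[μ] ℝ) (z : ℕ → K), Tendsto (fun n => T (z n)) atTop (𝓝 g) →
      (∀ᵐ h ∂μ, Tendsto (fun n => ⟪h, z n⟫_ℝ) atTop (𝓝 (Y h))) → X g = Y := by
    intro g Y z hz hY
    exact AEEqFun.ext (tendstoInMeasure_ae_unique (hall g z hz)
      (tendstoInMeasure_of_tendsto_ae (fun n => hmeas _) hY))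
  refine ⟨{ toFun := X, map_add' := fun g g' => ?_, map_smul' := fun r g => ?_ },
    fun g => ⟨y g, hy g, hX g⟩, hall⟩
  · refine hae _ _ (fun n => y g n + y g' n) ?_ ?_
    · simpa only [map_add] using (hy g).add (hy g')
    · filter_upwards [hX g, hX g', AEEqFun.coeFn_add (X g) (X g')] with h h1 h2 h3
      rw [h3, Pi.add_apply]
      simpa only [inner_add_right] using h1.add h2
  · refine hae _ _ (fun n => r • y g n) ?_ ?_
    · simpa only [map_smul] using (hy g).const_smul r
    · filter_upwards [hX g, AEEqFun.coeFn_smul r (X g)] with h h1 h3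
      rw [RingHom.id_apply, h3, Pi.smul_apply, smul_eq_mul]
      simpa only [real_inner_smul_right] using h1.const_mul r

variable [CompleteSpace H] [CompleteSpace K]

/-- A measure on a nuclear extension whose characteristic function factors through a function
continuous at the origin carries a measurable pairing. -/
theorem exists_isMeasurablePairing {J : H →L[ℝ] K}
    (hJ : IsNuclearExtension J) (μ : Measure K) [IsFiniteMeasure μ] {φ : H → ℂ}
    (hφ : ContinuousAt φ 0)
    (hμ : ∀ y, charFun μ y = φ (ContinuousLinearMap.adjoint J y)) :
    ∃ Φ : H →ₗ[ℝ] (K →ₘ[μ] ℝ), IsMeasurablePairing J Φ := by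
  have hδ := fun (ε : ℝ) (hε : 0 < ε) => exists_measure_inner_le μ hφ hμ hε
  obtain ⟨Φ, hΦ, hall⟩ := exists_linearMap_ae_tendsto hJ.denseRange_adjoint hδ
  refine ⟨Φ, fun g => ?_, fun y => ?_, fun u g hu => ?_⟩
  · obtain ⟨y, -, hy⟩ := hΦ g
    exact isLinearMeasurableFunctional_of_ae_tendsto hy
  · refine tendstoInMeasure_ae_unique (hall _ (fun _ => y) tendsto_const_nhds)
      (tendstoInMeasure_of_tendsto_ae (fun n => ?_)
        (Eventually.of_forall fun h => tendsto_const_nhds))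
    exact (by fun_prop : Continuous fun h : K => ⟪h, y⟫_ℝ).aestronglyMeasurable
  · refine tendstoInMeasure_of_forall_eventually_le fun ε hε => ?_
    obtain ⟨δ, hδ, hδμ⟩ := hδ (ε / 2) (half_pos hε)
    have hsmall : ∀ g : H, ‖g‖ < δ → μ {h | ε ≤ ‖Φ g h‖} ≤ ENNReal.ofReal ε := by
      intro g hg
      obtain ⟨y, hy, -⟩ := hΦ g
      have h1 := (tendstoInMeasure_iff_norm.1 (hall g y hy)) (ε / 2) (half_pos hε)
      have h2 := (ENNReal.tendsto_nhds_zero.1 h1) (ENNReal.ofReal (ε / 2)) (by simpa using hε)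
      obtain ⟨n, hn1, hn2⟩ := (h2.and (hy.norm.eventually (gt_mem_nhds hg))).exists
      calc μ {h | ε ≤ ‖Φ g h‖} ≤ μ ({h | ε / 2 ≤ ‖⟪h, y n⟫_ℝ - Φ g h‖} ∪
            {h | ε / 2 ≤ ‖⟪h, y n⟫_ℝ‖}) := by
            refine measure_mono fun h hh => ?_
            have hh : ε ≤ ‖Φ g h‖ := hh
            by_contra hcon
            have hcon' : ¬ (ε / 2 ≤ ‖⟪h, y n⟫_ℝ - Φ g h‖ ∨ ε / 2 ≤ ‖⟪h, y n⟫_ℝ‖) := hcon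
            rw [not_or, not_le, not_le] at hcon'
            have := norm_sub_le ⟪h, y n⟫_ℝ (⟪h, y n⟫_ℝ - Φ g h)
            rw [sub_sub_cancel] at this
            linarith [hcon'.1, hcon'.2]
        _ ≤ ENNReal.ofReal (ε / 2) + ENNReal.ofReal (ε / 2) :=
            (measure_union_le _ _).trans (add_le_add hn1 (hδμ _ hn2))
        _ = ENNReal.ofReal ε := by
            rw [← ENNReal.ofReal_add (by positivity) (by positivity), add_halves]
    have h1 : Tendsto (fun n => ‖u n - g‖) atTop (𝓝 0) := tendsto_iff_norm_sub_tendsto_zero.1 hu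
    filter_upwards [h1.eventually (gt_mem_nhds hδ)] with n hn
    refine le_trans (measure_mono_ae ?_) (hsmall _ hn)
    filter_upwards [AEEqFun.coeFn_sub (Φ (u n)) (Φ g)] with h hh hmem
    change ε ≤ ‖Φ (u n - g) h‖
    rw [map_sub, hh]
    exact hmem

end MeasurablePairing

/-! ### Unitary operators from equal Gram matrices. -/

section GramMatrix

variable {I E F : Type*} [NormedAddCommGroup E] [InnerProductSpace ℂ E]
  [NormedAddCommGroup F] [InnerProductSpace ℂ F]

theorem norm_linearCombination_eq_of_inner_eq {a : I → E} {b : I → F}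
    (h : ∀ i j, ⟪a i, a j⟫_ℂ = ⟪b i, b j⟫_ℂ) (c : I →₀ ℂ) :
    ‖Finsupp.linearCombination ℂ a c‖ = ‖Finsupp.linearCombination ℂ b c‖ := by
  rw [← sq_eq_sq₀ (norm_nonneg _) (norm_nonneg _)]
  have : ⟪Finsupp.linearCombination ℂ a c, Finsupp.linearCombination ℂ a c⟫_ℂ =
      ⟪Finsupp.linearCombination ℂ b c, Finsupp.linearCombination ℂ b c⟫_ℂ := by
    simp only [Finsupp.linearCombination_apply, Finsupp.sum, sum_inner, inner_sum,
      inner_smul_left, inner_smul_right, h]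
  rw [inner_self_eq_norm_sq_to_K, inner_self_eq_norm_sq_to_K] at this
  exact_mod_cast this

/-- Two total families with the same Gram matrix are related by a unitary operator. -/
theorem exists_linearIsometryEquiv_of_inner_eq [CompleteSpace E] [CompleteSpace F]
    {a : I → E} {b : I → F} (h : ∀ i j, ⟪a i, a j⟫_ℂ = ⟪b i, b j⟫_ℂ)
    (ha : Dense (Submodule.span ℂ (Set.range a) : Set E))
    (hb : Dense (Submodule.span ℂ (Set.range b) : Set F)) :
    ∃ U : E ≃ₗᵢ[ℂ] F, ∀ i, U (a i) = b i := by
  have hda : DenseRange (Finsupp.linearCombination ℂ a) := by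
    rw [DenseRange, ← LinearMap.coe_range, Finsupp.range_linearCombination]
    exact ha
  have hdb : DenseRange (Finsupp.linearCombination ℂ b) := by
    rw [DenseRange, ← LinearMap.coe_range, Finsupp.range_linearCombination]
    exact hb
  have hn : ∀ c, ‖Finsupp.linearCombination ℂ b (LinearEquiv.refl ℂ (I →₀ ℂ) c)‖ =
      ‖Finsupp.linearCombination ℂ a c‖ := fun c =>
    (norm_linearCombination_eq_of_inner_eq h c).symm
  refine ⟨(LinearEquiv.refl ℂ (I →₀ ℂ)).extendOfIsometry (Finsupp.linearCombination ℂ a)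
    (Finsupp.linearCombination ℂ b) hda hdb hn, fun i => ?_⟩
  have := LinearEquiv.extendOfIsometry_eq (LinearEquiv.refl ℂ (I →₀ ℂ))
    (Finsupp.linearCombination ℂ a) (Finsupp.linearCombination ℂ b) hda hdb hn
    (Finsupp.single i 1)
  simpa using this

end GramMatrix

/-! ### Injectivity of the Fourier transform on `L¹(μ)`. -/

section FourierInjective

variable {K : Type*} [NormedAddCommGroup K] [InnerProductSpace ℝ K] [CompleteSpace K]
  [SecondCountableTopology K] [MeasurableSpace K] [BorelSpace K]

/-- The positive and negative parts of `G` are densities of finite measures with equal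
characteristic functions, hence of equal measures. -/
theorem ae_eq_zero_of_integral_exp_eq_zero_real {μ : Measure K} {G : K → ℝ}
    (hG : Integrable G μ)
    (h : ∀ y : K, ∫ x, Complex.exp (⟪x, y⟫_ℝ * Complex.I) * (G x : ℂ) ∂μ = 0) :
    G =ᵐ[μ] 0 := by
  obtain ⟨g, hgm, hg⟩ := hG.1
  have hgi : Integrable g μ := hG.congr hg
  have hp : Measurable fun x => ENNReal.ofReal (g x) := hgm.measurable.ennreal_ofReal
  have hn : Measurable fun x => ENNReal.ofReal (-g x) := hgm.measurable.neg.ennreal_ofReal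
  have hpf : ∫⁻ x, ENNReal.ofReal (g x) ∂μ ≠ ⊤ := hgi.lintegral_lt_top.ne
  have hnf : ∫⁻ x, ENNReal.ofReal (-g x) ∂μ ≠ ⊤ := hgi.neg.lintegral_lt_top.ne
  have := isFiniteMeasure_withDensity hpf
  have := isFiniteMeasure_withDensity hnf
  have hexp : ∀ (y : K) (f : K → ℝ), Integrable f μ →
      Integrable (fun x => Complex.exp (⟪x, y⟫_ℝ * Complex.I) * (f x : ℂ)) μ := by
    intro y f hf
    refine hf.ofReal.bdd_mul (c := 1) (Continuous.aestronglyMeasurable (by fun_prop)) ?_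
    exact Eventually.of_forall fun x => by rw [Complex.norm_exp_ofReal_mul_I]
  have heq : μ.withDensity (fun x => ENNReal.ofReal (g x)) =
      μ.withDensity fun x => ENNReal.ofReal (-g x) := by
    refine Measure.ext_of_charFun (funext fun y => ?_)
    rw [charFun_apply, charFun_apply, integral_withDensity_eq_integral_toReal_smul hp
      (Eventually.of_forall fun x => ENNReal.ofReal_lt_top),
      integral_withDensity_eq_integral_toReal_smul hn
      (Eventually.of_forall fun x => ENNReal.ofReal_lt_top), ← sub_eq_zero, ← integral_sub]
    · rw [← h y]
      refine integral_congr_ae ?_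
      filter_upwards [hg] with x hx
      have : (ENNReal.ofReal (g x)).toReal - (ENNReal.ofReal (-g x)).toReal = g x := by
        rw [ENNReal.toReal_ofReal', ENNReal.toReal_ofReal']
        exact max_zero_sub_max_neg_zero_eq_self (g x)
      rw [hx, ← sub_smul, this, Complex.real_smul, mul_comm]
    · refine (hexp y _ hgi.pos_part).congr (Eventually.of_forall fun x => ?_)
      simp only [ENNReal.toReal_ofReal', Complex.real_smul, mul_comm]
    · refine (hexp y _ hgi.neg_part).congr (Eventually.of_forall fun x => ?_)
      simp only [ENNReal.toReal_ofReal', Complex.real_smul, mul_comm]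
  rw [withDensity_eq_iff hp.aemeasurable hn.aemeasurable hpf] at heq
  filter_upwards [heq, hg] with x hx hx'
  have h1 := congrArg ENNReal.toReal hx
  rw [ENNReal.toReal_ofReal', ENNReal.toReal_ofReal'] at h1
  rw [hx', Pi.zero_apply, ← max_zero_sub_max_neg_zero_eq_self (g x), h1, sub_self]

/-- An integrable function is determined by its Fourier transform. -/
theorem ae_eq_zero_of_integral_exp_eq_zero {μ : Measure K} {G : K → ℂ}
    (hG : Integrable G μ)
    (h : ∀ y : K, ∫ x, Complex.exp (⟪x, y⟫_ℝ * Complex.I) * G x ∂μ = 0) :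
    G =ᵐ[μ] 0 := by
  have hexp : ∀ (y : K) (f : K → ℂ), Integrable f μ →
      Integrable (fun x => Complex.exp (⟪x, y⟫_ℝ * Complex.I) * f x) μ := by
    intro y f hf
    refine hf.bdd_mul (c := 1) (Continuous.aestronglyMeasurable (by fun_prop)) ?_
    exact Eventually.of_forall fun x => by rw [Complex.norm_exp_ofReal_mul_I]
  have hre : ∀ G : K → ℂ, Integrable G μ →
      (∀ y : K, ∫ x, Complex.exp (⟪x, y⟫_ℝ * Complex.I) * G x ∂μ = 0) →
      (fun x => (G x).re) =ᵐ[μ] 0 := by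
    intro G hG h
    refine ae_eq_zero_of_integral_exp_eq_zero_real hG.re fun y => ?_
    -- Conjugation replaces `y` by `-y`, so the transform of the conjugate of `G` vanishes too, and
    -- with it that of `Re G`. The imaginary part of `G` is the real part of `-i G`.
    have hconj : ∫ x, Complex.exp (⟪x, y⟫_ℝ * Complex.I) * (starRingEnd ℂ) (G x) ∂μ = 0 := by
      have := congrArg (starRingEnd ℂ) (h (-y))
      rw [← integral_conj, map_zero] at this
      rw [← this]
      refine integral_congr_ae (Eventually.of_forall fun x => ?_)
      simp only [map_mul, ← Complex.exp_conj, Complex.conj_I, Complex.conj_ofReal, inner_neg_right,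
        map_neg, Complex.ofReal_neg, mul_neg, neg_mul, neg_neg]
    have hstar : Integrable (fun x => (starRingEnd ℂ) (G x)) μ :=
      (Complex.conjLIE.toContinuousLinearEquiv.toContinuousLinearMap.integrable_comp hG)
    have h2 : ∀ x, Complex.exp (⟪x, y⟫_ℝ * Complex.I) * ((G x).re : ℂ) =
        (1 / 2 : ℂ) * (Complex.exp (⟪x, y⟫_ℝ * Complex.I) * G x +
          Complex.exp (⟪x, y⟫_ℝ * Complex.I) * (starRingEnd ℂ) (G x)) := fun x => by
      rw [Complex.re_eq_add_conj]; ring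
    change ∫ x, Complex.exp (⟪x, y⟫_ℝ * Complex.I) * ((G x).re : ℂ) ∂μ = 0
    simp_rw [h2]
    rw [integral_const_mul, integral_add (hexp y _ hG) (hexp y _ hstar), h, hconj, add_zero,
      mul_zero]
  have h1 := hre G hG h
  have h2 := hre (fun x => -Complex.I * G x) (hG.const_mul _) fun y => by
    simp_rw [mul_left_comm _ (-Complex.I)]
    rw [integral_const_mul, h, mul_zero]
  filter_upwards [h1, h2] with x hx1 hx2
  refine Complex.ext hx1 ?_
  simpa using hx2

end FourierInjective

/-! ### Uniqueness of the pairing and totality criteria. -/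

section Realization

variable {H K 𝓗 : Type*} [NormedAddCommGroup H] [InnerProductSpace ℝ H] [CompleteSpace H]
  [NormedAddCommGroup K] [InnerProductSpace ℝ K] [CompleteSpace K]
  [MeasurableSpace K]
  [NormedAddCommGroup 𝓗] [InnerProductSpace ℂ 𝓗] [CompleteSpace 𝓗]

/-- The pairing is the a.e. limit of continuous functionals, simultaneously for two pairings. -/
theorem IsMeasurablePairing.ae_eq_of_absolutelyContinuous {J : H →L[ℝ] K}
    (hJ : IsNuclearExtension J) {μ ν : Measure K} (hνμ : ν ≪ μ)
    {Φ : H →ₗ[ℝ] (K →ₘ[μ] ℝ)} {Ψ : H →ₗ[ℝ] (K →ₘ[ν] ℝ)}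
    (hΦ : IsMeasurablePairing J Φ) (hΨ : IsMeasurablePairing J Ψ) (g : H) :
    (Φ g : K → ℝ) =ᵐ[ν] Ψ g := by
  obtain ⟨u, hu, hug⟩ := mem_closure_iff_seq_limit.1 (hJ.denseRange_adjoint g)
  choose y hy using hu
  obtain rfl : (fun n => ContinuousLinearMap.adjoint J (y n)) = u := funext hy
  -- Two successive subsequences make both pairings almost everywhere limits of the same functionals
  -- `⟪·, y n⟫`.
  obtain ⟨ns, hns, h1⟩ := (hΦ.tendsto_inMeasure _ _ hug).exists_seq_tendsto_ae
  obtain ⟨ms, hms, h2⟩ := (hΨ.tendsto_inMeasure _ _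
    (hug.comp hns.tendsto_atTop)).exists_seq_tendsto_ae
  have h3 : ∀ᵐ h ∂ν, ∀ n, Φ (ContinuousLinearMap.adjoint J (y n)) h = ⟪h, y n⟫_ℝ :=
    ae_all_iff.2 fun n => hνμ.ae_le (hΦ.apply_adjoint (y n))
  have h4 : ∀ᵐ h ∂ν, ∀ n, Ψ (ContinuousLinearMap.adjoint J (y n)) h = ⟪h, y n⟫_ℝ :=
    ae_all_iff.2 fun n => hΨ.apply_adjoint (y n)
  filter_upwards [hνμ.ae_le h1, h2, h3, h4] with h h1 h2 h3 h4
  simp only [h3] at h1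
  simp only [Function.comp_apply, h4] at h2
  exact tendsto_nhds_unique (h1.comp hms.tendsto_atTop) h2

theorem IsMeasurablePairing.eq {J : H →L[ℝ] K} (hJ : IsNuclearExtension J) {μ : Measure K}
    {Φ Ψ : H →ₗ[ℝ] (K →ₘ[μ] ℝ)} (hΦ : IsMeasurablePairing J Φ) (hΨ : IsMeasurablePairing J Ψ) :
    Φ = Ψ :=
  LinearMap.ext fun g =>
    AEEqFun.ext (hΦ.ae_eq_of_absolutelyContinuous hJ Measure.AbsolutelyContinuous.rfl hΨ g)

/-- Known on the dense range of `J*`, the identity passes to all of `H` by dominated convergence. -/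
theorem IsMeasurablePairing.integral_exp {J : H →L[ℝ] K} (hJ : IsNuclearExtension J)
    {μ : Measure K} [IsFiniteMeasure μ] {Φ : H →ₗ[ℝ] (K →ₘ[μ] ℝ)} (hΦ : IsMeasurablePairing J Φ)
    {φ : H → ℂ} (hφ : Continuous φ)
    (hμ : ∀ y, charFun μ y = φ (ContinuousLinearMap.adjoint J y)) (g : H) :
    ∫ h, Complex.exp (Complex.I * Φ g h) ∂μ = φ g := by
  obtain ⟨u, hu, hug⟩ := mem_closure_iff_seq_limit.1 (hJ.denseRange_adjoint g)
  choose y hy using hu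
  obtain rfl : (fun n => ContinuousLinearMap.adjoint J (y n)) = u := funext hy
  obtain ⟨ns, hns, h1⟩ := (hΦ.tendsto_inMeasure _ _ hug).exists_seq_tendsto_ae
  have h3 : ∀ n, ∫ h, Complex.exp (Complex.I * Φ (ContinuousLinearMap.adjoint J (y n)) h) ∂μ =
      φ (ContinuousLinearMap.adjoint J (y n)) := by
    intro n
    rw [← hμ, charFun_apply]
    refine integral_congr_ae ?_
    filter_upwards [hΦ.apply_adjoint (y n)] with h hh
    rw [hh, mul_comm]
  refine tendsto_nhds_unique (tendsto_integral_of_dominated_convergence (μ := μ)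
    (F := fun n h => Complex.exp (Complex.I * Φ (ContinuousLinearMap.adjoint J (y (ns n))) h))
    (fun _ => 1) (fun n => aestronglyMeasurable_exp_I_mul (AEEqFun.aestronglyMeasurable _))
    (integrable_const _) (fun n => Eventually.of_forall fun h => ?_) ?_) ?_
  · rw [Complex.norm_exp_I_mul_ofReal]
  · filter_upwards [h1] with h hh
    exact ((by fun_prop : Continuous fun t : ℝ => Complex.exp (Complex.I * t)).tendsto _).comp hh
  · simp_rw [h3]
    exact (hφ.tendsto g).comp (hug.comp hns.tendsto_atTop)

theorem dense_span_of_forall_inner_eq_zero {E : Type*} [NormedAddCommGroup E]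
    [InnerProductSpace ℂ E] [CompleteSpace E] {s : Set E}
    (h : ∀ x, (∀ a ∈ s, ⟪a, x⟫_ℂ = 0) → x = 0) : Dense (Submodule.span ℂ s : Set E) := by
  rw [Submodule.dense_iff_topologicalClosure_eq_top, Submodule.topologicalClosure_eq_top_iff,
    Submodule.eq_bot_iff]
  exact fun x hx => h x fun a ha => (Submodule.mem_orthogonal _ _).1 hx a (Submodule.subset_span ha)

theorem eq_zero_of_dense_span {E : Type*} [NormedAddCommGroup E]
    [InnerProductSpace ℂ E] {s : Set E} (hs : Dense (Submodule.span ℂ s : Set E)) {x : E}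
    (h : ∀ a ∈ s, ⟪a, x⟫_ℂ = 0) : x = 0 := by
  refine hs.eq_zero_of_inner_right ℂ fun v hv => ?_
  induction hv using Submodule.span_induction with
  | mem a ha => exact h a ha
  | zero => exact inner_zero_left _
  | add a b _ _ ha hb => rw [inner_add_left, ha, hb, add_zero]
  | smul c a _ ha => rw [inner_smul_left, ha, mul_zero]

end Realization

theorem MeasureTheory.Lp.lintegral_enorm_sq_ne_top {α : Type*} [MeasurableSpace α] {μ : Measure α}
    (f : Lp ℂ 2 μ) : ∫⁻ k, ‖f k‖ₑ ^ 2 ∂μ ≠ ⊤ := by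
  have := lintegral_rpow_enorm_lt_top_of_eLpNorm_lt_top (by norm_num) (by norm_num)
    (Lp.eLpNorm_lt_top f)
  simpa using this.ne

/-! ### Existence and uniqueness of spectral realizations. -/

section SpectralRealization

variable {H K 𝓗 : Type*} [NormedAddCommGroup H] [InnerProductSpace ℝ H] [CompleteSpace H]
  [NormedAddCommGroup K] [InnerProductSpace ℝ K] [CompleteSpace K]
  [MeasurableSpace K]
  [NormedAddCommGroup 𝓗] [InnerProductSpace ℂ 𝓗]

theorem representation_add_apply {G : Type*} [AddCommGroup G]
    (π : Multiplicative G →* (𝓗 ≃ₗᵢ[ℂ] 𝓗)) (g g' : G) (x : 𝓗) :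
    π (Multiplicative.ofAdd (g + g')) x =
      π (Multiplicative.ofAdd g) (π (Multiplicative.ofAdd g') x) := by
  rw [ofAdd_add, map_mul, LinearIsometryEquiv.coe_mul, Function.comp_apply]

theorem representation_zero_apply {G : Type*} [AddCommGroup G]
    (π : Multiplicative G →* (𝓗 ≃ₗᵢ[ℂ] 𝓗)) (x : 𝓗) :
    π (Multiplicative.ofAdd 0) x = x := by
  rw [ofAdd_zero, map_one, LinearIsometryEquiv.coe_one, id]

variable {J : H →L[ℝ] K} {π : Multiplicative H →* (𝓗 ≃ₗᵢ[ℂ] 𝓗)} {μ : Measure K}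
  {Φ : H →ₗ[ℝ] (K →ₘ[μ] ℝ)} {U : 𝓗 ≃ₗᵢ[ℂ] Lp ℂ 2 μ}

theorem IsSpectralRealization.map_apply (h : IsSpectralRealization J π Φ U) (g : H) (x : 𝓗) :
    U (π (Multiplicative.ofAdd g) x) =ᵐ[μ] fun k => Complex.exp (Complex.I * Φ g k) * U x k := by
  have := h.multiplication g (U x)
  rwa [U.symm_apply_apply] at this

theorem IsSpectralRealization.map_adjoint_apply (h : IsSpectralRealization J π Φ U) (y : K)
    (x : 𝓗) : U (π (Multiplicative.ofAdd (ContinuousLinearMap.adjoint J y)) x) =ᵐ[μ]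
      fun k => Complex.exp (⟪k, y⟫_ℝ * Complex.I) * U x k := by
  filter_upwards [h.map_apply (ContinuousLinearMap.adjoint J y) x, h.pairing.apply_adjoint y]
    with k h1 h2
  rw [h1, h2, mul_comm Complex.I]

/-- A cyclic vector corresponds to an almost everywhere nonzero function. -/
theorem IsSpectralRealization.ae_ne_zero [IsFiniteMeasure μ] (h : IsSpectralRealization J π Φ U)
    {v : 𝓗} (hv : IsCyclicVector π v) : ∀ᵐ k ∂μ, U v k ≠ 0 := by
  have hZ : MeasurableSet {k | U v k = 0} :=
    (Lp.stronglyMeasurable (U v)).measurable (measurableSet_singleton 0)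
  set F : Lp ℂ 2 μ := indicatorConstLp 2 hZ (measure_ne_top _ _) 1 with hF
  have hcoe : F =ᵐ[μ] Set.indicator {k | U v k = 0} fun _ => (1 : ℂ) := indicatorConstLp_coeFn
  -- The indicator of the zero set of `U v` is orthogonal to the whole orbit of `v`.
  have h0 : U.symm F = 0 := by
    refine eq_zero_of_dense_span hv ?_
    rintro _ ⟨g, rfl⟩
    rw [← U.inner_map_map, U.apply_symm_apply, L2.inner_def]
    refine integral_eq_zero_of_ae ?_
    filter_upwards [h.map_apply g v, hcoe] with k h1 h2
    rw [h1, h2, Pi.zero_apply]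
    by_cases hk : U v k = 0
    · rw [hk, mul_zero, inner_zero_left]
    · rw [Set.indicator_of_notMem (by exact hk), inner_zero_right]
  have hF0 : F = 0 := by rw [← U.apply_symm_apply F, h0, map_zero]
  filter_upwards [hcoe, Lp.coeFn_zero ℂ 2 μ] with k h1 h2 hk
  rw [hF0, h2, Set.indicator_of_mem (by exact hk)] at h1
  exact zero_ne_one h1

variable [BorelSpace K]

/-- The matrix coefficient of a vector is the characteristic function of the measure whose density
is the squared modulus of the corresponding function. -/
theorem IsSpectralRealization.charFun_withDensity (h : IsSpectralRealization J π Φ U)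
    (v : 𝓗) (y : K) :
    charFun (μ.withDensity fun k => ‖U v k‖ₑ ^ 2) y =
      ⟪v, π (Multiplicative.ofAdd (ContinuousLinearMap.adjoint J y)) v⟫_ℂ := by
  rw [charFun_apply, integral_withDensity_eq_integral_toReal_smul
    ((Lp.stronglyMeasurable (U v)).enorm.pow_const 2) (Eventually.of_forall fun k => by simp),
    ← U.inner_map_map, L2.inner_def]
  refine integral_congr_ae ?_
  filter_upwards [h.map_adjoint_apply y v] with k hk
  rw [hk, ← smul_eq_mul (Complex.exp (⟪k, y⟫_ℝ * Complex.I)), inner_smul_right, inner_self_eq_norm_sq_to_K]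
  simp [mul_comm]

/-- A finite Borel measure on the separable space `K` is determined by its characteristic function.
The right-hand side does not mention the realization; all uniqueness of measures comes from this. -/
theorem IsSpectralRealization.withDensity_eq [SecondCountableTopology K]
    (h : IsSpectralRealization J π Φ U) {v : 𝓗} {ν : Measure K} [IsFiniteMeasure ν]
    (hν : ∀ y, charFun ν y = ⟪v, π (Multiplicative.ofAdd (ContinuousLinearMap.adjoint J y)) v⟫_ℂ) :
    μ.withDensity (fun k => ‖U v k‖ₑ ^ 2) = ν := by
  have := isFiniteMeasure_withDensity (Lp.lintegral_enorm_sq_ne_top (U v))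
  exact Measure.ext_of_charFun (funext fun y => by rw [h.charFun_withDensity, hν])

/-- A vector corresponding to an almost everywhere nonzero function is cyclic. -/
theorem IsSpectralRealization.isCyclicVector [SecondCountableTopology K] [CompleteSpace 𝓗]
    (h : IsSpectralRealization J π Φ U) {w : 𝓗} (hw : ∀ᵐ k ∂μ, U w k ≠ 0) :
    IsCyclicVector π w := by
  refine dense_span_of_forall_inner_eq_zero fun x hx => ?_
  have hG : Integrable (fun k => ⟪U w k, U x k⟫_ℂ) μ := L2.integrable_inner (U w) (U x)
  -- Orthogonality of `x` to the orbit says that the Fourier transform of `⟪U w, U x⟫` vanishes. The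
  -- sign `-y` compensates the conjugation in the first slot.
  have h0 := ae_eq_zero_of_integral_exp_eq_zero hG fun y => by
    rw [← hx _ ⟨ContinuousLinearMap.adjoint J (-y), rfl⟩, ← U.inner_map_map, L2.inner_def]
    refine integral_congr_ae ?_
    filter_upwards [h.map_adjoint_apply (-y) w] with k hk
    rw [hk, ← smul_eq_mul (Complex.exp (⟪k, -y⟫_ℝ * Complex.I)), inner_smul_left,
      ← Complex.exp_conj]
    simp
  refine U.injective ?_
  rw [map_zero]
  ext1
  filter_upwards [h0, hw, Lp.coeFn_zero ℂ 2 μ] with k h1 h2 h3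
  rw [h3, Pi.zero_apply]
  simpa [h2] using h1

/-- The orbit of `w` and the exponentials `exp (i⟨·, g⟩)` have the same Gram matrix, and both are
total. The resulting unitary intertwines `π(g)` with multiplication because it does so on the orbit.
-/
theorem exists_isSpectralRealization [SecondCountableTopology K] [CompleteSpace 𝓗]
    (hJ : IsNuclearExtension J)
    (hπ : ∀ x : 𝓗, Continuous fun g : H => π (Multiplicative.ofAdd g) x)
    {w : 𝓗} (hw : IsCyclicVector π w) (μ : Measure K) [IsFiniteMeasure μ]
    (hμ : ∀ y, charFun μ y =
      ⟪w, π (Multiplicative.ofAdd (ContinuousLinearMap.adjoint J y)) w⟫_ℂ) :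
    ∃ (Φ : H →ₗ[ℝ] (K →ₘ[μ] ℝ)) (U : 𝓗 ≃ₗᵢ[ℂ] Lp ℂ 2 μ),
      IsSpectralRealization J π Φ U ∧ U w =ᵐ[μ] fun _ => (1 : ℂ) := by
  have hφ : Continuous fun g : H => ⟪w, π (Multiplicative.ofAdd g) w⟫_ℂ := by
    have := hπ w; fun_prop
  obtain ⟨Φ, hΦ⟩ := exists_isMeasurablePairing hJ μ hφ.continuousAt hμ
  have hint := hΦ.integral_exp hJ hφ hμ
  have h1 : MemLp (fun _ : K => (1 : ℂ)) 2 μ := memLp_const 1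
  let M : H → (Lp ℂ 2 μ →ₗᵢ[ℂ] Lp ℂ 2 μ) := fun g =>
    phaseMul ℂ (Φ g) (AEEqFun.aestronglyMeasurable (Φ g))
  have hM : ∀ g F, M g F =ᵐ[μ] fun k => Complex.exp (Complex.I * Φ g k) * F k :=
    fun g F => coeFn_phaseMul _ _ F
  let e : H → Lp ℂ 2 μ := fun g => M g (h1.toLp _)
  have he : ∀ g, e g =ᵐ[μ] fun k => Complex.exp (Complex.I * Φ g k) := by
    intro g
    filter_upwards [hM g (h1.toLp _), h1.coeFn_toLp] with k h2 h3
    rw [h2, h3, mul_one]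
  have hgram : ∀ g g', ⟪π (Multiplicative.ofAdd g) w, π (Multiplicative.ofAdd g') w⟫_ℂ =
      ⟪e g, e g'⟫_ℂ := by
    intro g g'
    rw [← add_sub_cancel g g', representation_add_apply, LinearIsometryEquiv.inner_map_map,
      ← hint, L2.inner_def, add_sub_cancel]
    refine integral_congr_ae ?_
    filter_upwards [he g, he g', AEEqFun.coeFn_sub (Φ g') (Φ g)] with k h2 h3 h4
    rw [h2, h3, map_sub, h4, Pi.sub_apply, RCLike.inner_apply, ← Complex.exp_conj,
      ← Complex.exp_add]
    congr 1
    simp only [map_mul, Complex.conj_I, Complex.conj_ofReal, Complex.ofReal_sub]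
    ring
  have hdense : Dense (Submodule.span ℂ (Set.range e) : Set (Lp ℂ 2 μ)) := by
    refine dense_span_of_forall_inner_eq_zero fun F hF => ?_
    have hFi : Integrable F μ := (Lp.memLp F).integrable (by norm_num)
    have h0 := ae_eq_zero_of_integral_exp_eq_zero hFi fun y => by
      rw [← hF _ ⟨ContinuousLinearMap.adjoint J (-y), rfl⟩, L2.inner_def]
      refine integral_congr_ae ?_
      filter_upwards [he (ContinuousLinearMap.adjoint J (-y)), hΦ.apply_adjoint (-y)] with k h2 h3
      rw [h2, h3, RCLike.inner_apply, ← Complex.exp_conj, mul_comm]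
      congr 2
      simp [mul_comm]
    ext1
    exact h0.trans (Lp.coeFn_zero ℂ 2 μ).symm
  obtain ⟨U, hU⟩ := exists_linearIsometryEquiv_of_inner_eq hgram hw hdense
  have hMe : ∀ g g', M g (e g') = e (g + g') := by
    intro g g'
    ext1
    filter_upwards [hM g (e g'), he g', he (g + g'), AEEqFun.coeFn_add (Φ g) (Φ g')]
      with k h2 h3 h4 h5
    rw [h2, h3, h4, map_add, h5, ← Complex.exp_add, Pi.add_apply, Complex.ofReal_add, mul_add]
  have hcomm : ∀ g x, U (π (Multiplicative.ofAdd g) x) = M g (U x) := by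
    intro g
    have : ((U : 𝓗 →L[ℂ] Lp ℂ 2 μ) ∘L (π (Multiplicative.ofAdd g) : 𝓗 →L[ℂ] 𝓗)) =
        ((M g).toContinuousLinearMap ∘L (U : 𝓗 →L[ℂ] Lp ℂ 2 μ)) := by
      refine ContinuousLinearMap.ext_on hw ?_
      rintro _ ⟨g', rfl⟩
      change U (π (Multiplicative.ofAdd g) (π (Multiplicative.ofAdd g') w)) =
        M g (U (π (Multiplicative.ofAdd g') w))
      rw [← representation_add_apply, hU, hU, hMe]
    exact fun x => congrArg (fun T : 𝓗 →L[ℂ] Lp ℂ 2 μ => T x) this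
  refine ⟨Φ, U, ⟨hΦ, fun g F => ?_⟩, ?_⟩
  · rw [hcomm, U.apply_symm_apply]
    exact hM g F
  · have h2 := hU 0
    rw [representation_zero_apply] at h2
    rw [h2]
    filter_upwards [he 0, AEEqFun.coeFn_zero (μ := μ) (β := ℝ)] with k h3 h4
    rw [h3, map_zero, h4]
    simp

/-- The matrix coefficient of any vector is the characteristic function of a finite measure. -/
theorem exists_isFiniteMeasure_charFun_eq [CompleteSpace 𝓗] (hJ : IsHilbertSchmidt J)
    (hπ : ∀ x : 𝓗, Continuous fun g : H => π (Multiplicative.ofAdd g) x) (v : 𝓗) :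
    ∃ μ : Measure K, IsFiniteMeasure μ ∧ ∀ y, charFun μ y =
      ⟪v, π (Multiplicative.ofAdd (ContinuousLinearMap.adjoint J y)) v⟫_ℂ := by
  rcases eq_or_ne v 0 with rfl | hv
  · exact ⟨0, inferInstance, fun y => by simp⟩
  have hv' : ‖v‖ ≠ 0 := norm_ne_zero_iff.2 hv
  obtain ⟨m, hm, hmc⟩ := exists_charFun_eq_inner_adjoint hJ π hπ ((‖v‖⁻¹ : ℂ) • v)
    (by simp [norm_smul, hv'])
  refine ⟨ENNReal.ofReal (‖v‖ ^ 2) • m, Measure.smul_finite _ ENNReal.ofReal_ne_top, fun y => ?_⟩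
  rw [charFun_apply, integral_smul_measure, ← charFun_apply, hmc, map_smul, inner_smul_left,
    inner_smul_right, ENNReal.toReal_ofReal (by positivity), Complex.real_smul]
  have : (‖v‖ : ℂ) ≠ 0 := by exact_mod_cast hv'
  simp only [map_inv₀, Complex.conj_ofReal]
  push_cast
  field_simp

/-- Equivalent measures are spectral measures of the same representations. -/
theorem IsSpectralRealization.isSpectralMeasure_of_absolutelyContinuous
    [SecondCountableTopology K] [CompleteSpace 𝓗] [IsFiniteMeasure μ]
    (hJ : IsNuclearExtension J)
    (hπ : ∀ x : 𝓗, Continuous fun g : H => π (Multiplicative.ofAdd g) x)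
    (h : IsSpectralRealization J π Φ U) {ν : Measure K} [IsFiniteMeasure ν] (hνμ : ν ≪ μ)
    (hμν : μ ≪ ν) : IsSpectralMeasure J π ν := by
  -- The vector `w` with `U w = √(dν/dμ)` satisfies `‖U w‖² μ = ν`, and it is cyclic because this
  -- function is nonzero `μ`-almost everywhere.
  have hs : MemLp (fun k => (√(ν.rnDeriv μ k).toReal : ℂ)) 2 μ := by
    have hm : Measurable fun k => (√(ν.rnDeriv μ k).toReal : ℂ) := by fun_prop
    rw [← memLp_norm_iff hm.aestronglyMeasurable]
    refine (memLp_two_iff_integrable_sq hm.norm.aestronglyMeasurable).2 ?_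
    refine Measure.integrable_toReal_rnDeriv (μ := ν) (ν := μ) |>.congr
      (Eventually.of_forall fun k => ?_)
    simp only [Complex.norm_real, Real.norm_eq_abs, sq_abs, Real.sq_sqrt ENNReal.toReal_nonneg]
  set w := U.symm (hs.toLp _) with hw
  have hUw : U w =ᵐ[μ] fun k => (√(ν.rnDeriv μ k).toReal : ℂ) := by
    rw [hw, U.apply_symm_apply]
    exact hs.coeFn_toLp
  have hne : ∀ᵐ k ∂μ, U w k ≠ 0 := by
    filter_upwards [hUw, Measure.rnDeriv_pos' hμν, Measure.rnDeriv_lt_top ν μ] with k h1 h2 h3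
    rw [h1, Complex.ofReal_ne_zero]
    exact (Real.sqrt_pos.2 (ENNReal.toReal_pos h2.ne' h3.ne)).ne'
  have hν : μ.withDensity (fun k => ‖U w k‖ₑ ^ 2) = ν := by
    rw [← Measure.withDensity_rnDeriv_eq ν μ hνμ]
    refine withDensity_congr_ae ?_
    filter_upwards [hUw, Measure.rnDeriv_lt_top ν μ] with k h1 h3
    rw [h1, ← ofReal_norm, ← ENNReal.ofReal_pow (norm_nonneg _), Complex.norm_real,
      Real.norm_eq_abs, sq_abs, Real.sq_sqrt ENNReal.toReal_nonneg, ENNReal.ofReal_toReal h3.ne]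
  obtain ⟨Ψ, V, hV, -⟩ := exists_isSpectralRealization hJ hπ (h.isCyclicVector hne) ν fun y => by
    rw [← h.charFun_withDensity, hν]
  exact ⟨Ψ, V, hV⟩

/-- Two realizations differ by multiplication by a function. -/
theorem IsSpectralRealization.exists_eq_mul [IsFiniteMeasure μ] (hJ : IsNuclearExtension J)
    (h : IsSpectralRealization J π Φ U) {ν : Measure K} (hνμ : ν ≪ μ)
    {Ψ : H →ₗ[ℝ] (K →ₘ[ν] ℝ)} {V : 𝓗 ≃ₗᵢ[ℂ] Lp ℂ 2 ν} (h' : IsSpectralRealization J π Ψ V)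
    {v : 𝓗} (hv : IsCyclicVector π v) :
    ∃ φ : K → ℂ, Measurable φ ∧ ∀ x : 𝓗, V x =ᵐ[ν] fun k => φ k * U x k := by
  -- The case `x = v` forces this quotient. On the orbit of `v` the phases of the two realizations
  -- agree `ν`-almost everywhere.
  refine ⟨fun k => V v k / U v k, (Lp.stronglyMeasurable (V v)).measurable.div
    (Lp.stronglyMeasurable (U v)).measurable, fun x => ?_⟩
  have hspan : ∀ x ∈ Submodule.span ℂ (Set.range fun g : H => π (Multiplicative.ofAdd g) v),
      V x =ᵐ[ν] fun k => V v k / U v k * U x k := by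
    intro x hx
    induction hx using Submodule.span_induction with
    | mem a ha =>
      obtain ⟨g, rfl⟩ := ha
      filter_upwards [h'.map_apply g v, hνμ.ae_le (h.map_apply g v), hνμ.ae_le (h.ae_ne_zero hv),
        h.pairing.ae_eq_of_absolutelyContinuous hJ hνμ h'.pairing g] with k h1 h2 h3 h4
      rw [h1, h2, h4]
      field_simp
    | zero =>
      rw [map_zero, map_zero]
      filter_upwards [Lp.coeFn_zero ℂ 2 ν, hνμ.ae_le (Lp.coeFn_zero ℂ 2 μ)] with k h1 h2
      rw [h1, h2]
      simp
    | add a b _ _ ha hb =>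
      rw [map_add, map_add]
      filter_upwards [Lp.coeFn_add (V a) (V b), hνμ.ae_le (Lp.coeFn_add (U a) (U b)), ha, hb]
        with k h1 h2 h3 h4
      rw [h1, h2, Pi.add_apply, Pi.add_apply, h3, h4, mul_add]
    | smul c a _ ha =>
      rw [map_smul, map_smul]
      filter_upwards [Lp.coeFn_smul c (V a), hνμ.ae_le (Lp.coeFn_smul c (U a)), ha]
        with k h1 h2 h3
      rw [h1, h2, Pi.smul_apply, Pi.smul_apply, h3, smul_eq_mul, smul_eq_mul, mul_left_comm]
  -- The factor may be unbounded, so the identity is extended from the span through almost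
  -- everywhere convergent subsequences.
  obtain ⟨u, hu, hux⟩ := mem_closure_iff_seq_limit.1 (hv x)
  obtain ⟨ns, hns, h1⟩ := (tendstoInMeasure_of_tendsto_Lp
    ((U.continuous.tendsto x).comp hux)).exists_seq_tendsto_ae
  obtain ⟨ms, hms, h2⟩ := (tendstoInMeasure_of_tendsto_Lp
    ((V.continuous.tendsto x).comp (hux.comp hns.tendsto_atTop))).exists_seq_tendsto_ae
  filter_upwards [hνμ.ae_le h1, h2, ae_all_iff.2 fun n => hspan _ (hu n)] with k h3 h4 h5
  refine tendsto_nhds_unique h4 ?_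
  simp only [Function.comp_apply, h5]
  exact (h3.comp hms.tendsto_atTop).const_mul _

/-- A finite spectral measure is equivalent to the measure defined by any cyclic vector. -/
theorem IsSpectralRealization.absolutelyContinuous [SecondCountableTopology K]
    [IsFiniteMeasure μ] (h : IsSpectralRealization J π Φ U) {v : 𝓗} (hv : IsCyclicVector π v)
    {m : Measure K} [IsFiniteMeasure m]
    (hm : ∀ y, charFun m y =
      ⟪v, π (Multiplicative.ofAdd (ContinuousLinearMap.adjoint J y)) v⟫_ℂ) :
    μ ≪ m ∧ m ≪ μ := by
  rw [← h.withDensity_eq hm]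
  refine ⟨withDensity_absolutelyContinuous'
    ((Lp.stronglyMeasurable (U v)).enorm.pow_const 2).aemeasurable ?_,
    withDensity_absolutelyContinuous _ _⟩
  filter_upwards [h.ae_ne_zero hv] with k hk
  simpa using hk

/-- A realization is determined by the function corresponding to a cyclic vector. -/
theorem IsSpectralRealization.eq_of_apply_eq (hJ : IsNuclearExtension J)
    (h : IsSpectralRealization J π Φ U) {Ψ : H →ₗ[ℝ] (K →ₘ[μ] ℝ)} {V : 𝓗 ≃ₗᵢ[ℂ] Lp ℂ 2 μ}
    (h' : IsSpectralRealization J π Ψ V) {v : 𝓗} (hv : IsCyclicVector π v) (hUV : U v = V v) :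
    Φ = Ψ ∧ U = V := by
  have hΦ := h.pairing.eq hJ h'.pairing
  subst hΦ
  refine ⟨rfl, ?_⟩
  have : (U : 𝓗 →L[ℂ] Lp ℂ 2 μ) = (V : 𝓗 →L[ℂ] Lp ℂ 2 μ) := by
    refine ContinuousLinearMap.ext_on hv ?_
    rintro _ ⟨g, rfl⟩
    change U (π (Multiplicative.ofAdd g) v) = V (π (Multiplicative.ofAdd g) v)
    ext1
    filter_upwards [h.map_apply g v, h'.map_apply g v] with k h1 h2
    rw [h1, h2, hUV]
  exact LinearIsometryEquiv.ext fun x => congrArg (fun T : 𝓗 →L[ℂ] Lp ℂ 2 μ => T x) this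

end SpectralRealization

/-! ### The spectral theorem. -/

theorem mainTheorem5
    {H : Type*} [NormedAddCommGroup H] [InnerProductSpace ℝ H] [CompleteSpace H]
    [TopologicalSpace.SeparableSpace H] (hH : ¬ FiniteDimensional ℝ H)
    {𝓗 : Type*} [NormedAddCommGroup 𝓗] [InnerProductSpace ℂ 𝓗] [CompleteSpace 𝓗]
    [TopologicalSpace.SeparableSpace 𝓗]
    (π : Multiplicative H →* (𝓗 ≃ₗᵢ[ℂ] 𝓗))
    (hπ : ∀ x : 𝓗, Continuous fun g : H => π (Multiplicative.ofAdd g) x)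
    (hcyc : ∃ v : 𝓗, IsCyclicVector π v)
    {K : Type*} [NormedAddCommGroup K] [InnerProductSpace ℝ K] [CompleteSpace K]
    [MeasurableSpace K] [BorelSpace K]
    (J : H →L[ℝ] K) (hJ : IsNuclearExtension J) :
    -- Existence of a spectral measure, determined exactly up to equivalence.
    (∃ μ : Measure K, IsFiniteMeasure μ ∧ IsSpectralMeasure J π μ ∧
      ∀ ν : Measure K, IsFiniteMeasure ν →
        (IsSpectralMeasure J π ν ↔ ν ≪ μ ∧ μ ≪ ν)) ∧
    -- Any two realizations differ by multiplication by a function.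
    (∀ (μ ν : Measure K), IsFiniteMeasure μ → IsFiniteMeasure ν →
      ∀ (Φ : H →ₗ[ℝ] (K →ₘ[μ] ℝ)) (U : 𝓗 ≃ₗᵢ[ℂ] Lp ℂ 2 μ)
        (Ψ : H →ₗ[ℝ] (K →ₘ[ν] ℝ)) (V : 𝓗 ≃ₗᵢ[ℂ] Lp ℂ 2 ν),
        IsSpectralRealization J π Φ U → IsSpectralRealization J π Ψ V →
        ∃ φ : K → ℂ, Measurable φ ∧ ∀ x : 𝓗, V x =ᵐ[ν] fun h => φ h * U x h) ∧
    -- A unit cyclic vector determines the realization and its measure completely.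
    (∀ v : 𝓗, IsCyclicVector π v → ‖v‖ = 1 →
      ∃ μ : Measure K, IsProbabilityMeasure μ ∧
        (∃! p : (H →ₗ[ℝ] (K →ₘ[μ] ℝ)) × (𝓗 ≃ₗᵢ[ℂ] Lp ℂ 2 μ),
          IsSpectralRealization J π p.1 p.2 ∧ p.2 v =ᵐ[μ] fun _ => (1 : ℂ)) ∧
        ∀ ν : Measure K, IsFiniteMeasure ν →
          ∀ (Ψ : H →ₗ[ℝ] (K →ₘ[ν] ℝ)) (V : 𝓗 ≃ₗᵢ[ℂ] Lp ℂ 2 ν),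
            IsSpectralRealization J π Ψ V → (V v =ᵐ[ν] fun _ => (1 : ℂ)) → ν = μ) := by
  have hsep : TopologicalSpace.SeparableSpace K := hJ.denseRange.separableSpace J.continuous
  have : SecondCountableTopology K := UniformSpace.secondCountable_of_separable K
  obtain ⟨v, hv⟩ := hcyc
  obtain ⟨μ, hμf, hμ⟩ := exists_isFiniteMeasure_charFun_eq hJ.hilbertSchmidt hπ v
  obtain ⟨Φ, U, hU, -⟩ := exists_isSpectralRealization hJ hπ hv μ hμ
  refine ⟨⟨μ, hμf, ⟨Φ, U, hU⟩, fun ν hν => ⟨?_, fun h => ?_⟩⟩, ?_, ?_⟩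
  · rintro ⟨Ψ, V, hV⟩
    exact hV.absolutelyContinuous hv hμ
  · exact hU.isSpectralMeasure_of_absolutelyContinuous hJ hπ h.1 h.2
  · intro μ₁ ν hμ₁ hν Φ₁ U₁ Ψ V hU₁ hV
    exact hU₁.exists_eq_mul hJ ((hV.absolutelyContinuous hv hμ).1.trans
      (hU₁.absolutelyContinuous hv hμ).2) hV hv
  · intro v hv hv1
    obtain ⟨μ, hμp, hμ⟩ := exists_charFun_eq_inner_adjoint hJ.hilbertSchmidt π hπ v hv1
    obtain ⟨Φ, U, hU, hU1⟩ := exists_isSpectralRealization hJ hπ hv μ hμ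
    refine ⟨μ, hμp, ⟨(Φ, U), ⟨hU, hU1⟩, ?_⟩, ?_⟩
    · rintro ⟨Ψ, V⟩ ⟨hV, hV1⟩
      obtain ⟨h1, h2⟩ := hV.eq_of_apply_eq hJ hU hv (Lp.ext (hV1.trans hU1.symm))
      exact Prod.ext h1 h2
    · intro ν hν Ψ V hV hV1
      -- With `V v = 1` the density `‖V v‖²` is `1`, so `ν` itself is the measure with the
      -- prescribed characteristic function.
      rw [← hV.withDensity_eq hμ]
      conv_lhs => rw [← withDensity_one (μ := ν)]
      refine withDensity_congr_ae ?_
      filter_upwards [hV1] with k hk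
      rw [hk]
      simp
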